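/- **Setting.** Let $\tilde A$ be an abelian group with subgroups $A_0\subset A\subset\tilde A$. Let $V$ be a strongly $A$-graded conformal vertex algebra: a conformal vertex algebra $V=\coprod_{n\in\mathbb Z}V_{(n)}$ with a compatible second grading $V=\coprod_{\alpha\in A}V^{(\alpha)}$ such that $\mathbf 1,\omega\in V^{(0)}$, $v_lV^{(\beta)}\subset V^{(\alpha+\beta)}$ for $v\in V^{(\alpha)}$, $\dim V^{(\alpha)}_{(n)}<\infty$, and $V^{(\alpha)}_{(n)}=0$ for $n$ sufficiently negative. Let $V_0\subset V$ be a vertex subalgebra strongly graded with respect to $A_0$, i.e. $\mathbf 1\in V_0$, $V_0$ is closed under all products $u_nv$, and $V_0=\coprod_{\alpha\in A_0,\,n\in\mathbb Z}V_0\cap V^{(\alpha)}_{(n)}$. A strongly $\tilde A$-graded generalized $V$-module is a generalized $V$-module $W=\coprod_{n\in\mathbb C}W_{[n]}$ (graded by generalized $L(0)$-eigenspaces) with a compatible second grading $W=\coprod_{\beta\in\tilde A}W^{(\beta)}$ such that $v_lW^{(\beta)}\subset W^{(\alpha+\beta)}$ for $v\in V^{(\alpha)}$, $\dim W^{(\beta)}_{[n]}<\infty$,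 and $W^{(\beta)}_{[n+k]}=0$ for $k\in\mathbb Z$ sufficiently negative. Its graded dual is $W'=\coprod_{\beta,n}(W')^{(\beta)}_{[n]}$ with $(W')^{(\beta)}_{[n]}=(W^{(-\beta)}_{[n]})^*$. **Hypotheses.** 1. Every strongly $\tilde A$-graded generalized $V$-module $W$ is $\mathbb R$-graded ($W_{[n]}=0$ for $n\notin\mathbb R$), lower bounded (for each $\beta$, $W^{(\beta)}_{[n]}=0$ when $\Re(n)$ is sufficiently negative) and $C_1$-cofinite as a $V_0$-module: $\dim W^{(\beta)}/(C_1(W)\cap W^{(\beta)})<\infty$ for all $\beta\in\tilde A$, where $C_1(W)$ is the span of all $u_{-1}w$ with $u\in\coprod_{n>0}(V_0)_{(n)}$ and $w\in W$. 2. For all strongly $\tilde A$-graded generalized $V$-modules $M_1,M_2,M_3$ and all $\beta_1,\beta_2\in\tilde A$, there are only finitely many pairs $(\tilde\beta_1,\tilde\beta_2)\in(\beta_1+A_0)\times(\beta_2+A_0)$ for which the fusion rule $N_{M_1^{(\tilde\beta_1)}M_2^{(\tilde\beta_2)}}^{M_3^{(\tilde\beta_1+\tilde\beta_2)}}$ is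 nonzero. This fusion rule is the dimension of the space of logarithmic intertwining operators of the indicated type, the homogeneous subspaces being viewed as generalized $V^{(0)}$-modules. **Conclusion.** Let $W_0,\dots,W_{n+1}$ and $\widetilde W_1,\dots,\widetilde W_{n-1}$ be strongly $\tilde A$-graded generalized $V$-modules, and let $\mathcal Y_1,\dots,\mathcal Y_n$ be grading-compatible logarithmic intertwining operators of types $$\binom{W_0}{W_1\,\widetilde W_1},\ \binom{\widetilde W_1}{W_2\,\widetilde W_2},\ \dots,\ \binom{\widetilde W_{n-2}}{W_{n-1}\,\widetilde W_{n-1}},\ \binom{\widetilde W_{n-1}}{W_n\,W_{n+1}}$$ (for $n=1$: of type $\binom{W_0}{W_1\,W_2}$). Then for any $\tilde A$-homogeneous elements $w_{(0)}'\in W_0'$, $w_{(1)}\in W_1,\dots,w_{(n+1)}\in W_{n+1}$ there exist an integer $m\ge1$ and $$a_{k,l}(z_1,\dots,z_n)\in\mathbb C[z_1^{\pm1},\dots,z_n^{\pm1},(z_1-z_2)^{-1},(z_1-z_3)^{-1},\dots,(z_{n-1}-z_n)^{-1}],\qquad 1\le k\le m,\ 1\le l\le n,$$ such that the series $$\varphi=\langle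 w_{(0)}',\mathcal Y_1(w_{(1)},z_1)\cdots\mathcal Y_n(w_{(n)},z_n)w_{(n+1)}\rangle,$$ a formal series in complex powers of the $z_i$ and nonnegative integral powers of the $\log z_i$, satisfies the system $$\frac{\partial^m\varphi}{\partial z_l^m}+\sum_{k=1}^m a_{k,l}(z_1,\dots,z_n)\frac{\partial^{m-k}\varphi}{\partial z_l^{m-k}}=0,\qquad l=1,\dots,n,$$ in the region $|z_1|>\cdots>|z_n|>0$. That is, the system holds as an identity of formal series when each $a_{k,l}$ is replaced by its Laurent expansion in that region. -/

import Mathlib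

universe u v w

noncomputable section

/-- Linear maps `v ↦ Y(v, x) = ∑ₙ vₙ x^(-n-1)` from `V` to `(End W)[[x, x⁻¹]]` that satisfy the lower
truncation condition; `Y.mode v n` is `vₙ`. -/
structure VertexAction (V : Type u) (W : Type w) [AddCommGroup V] [Module ℂ V]
    [AddCommGroup W] [Module ℂ W] where
  mode : V →ₗ[ℂ] (ℤ → Module.End ℂ W)
  truncation : ∀ (v : V) (x : W), ∃ N : ℤ, ∀ n ≥ N, mode v n x = 0

/-- The operators `L(n) = ω_{n+1}`. -/
def VertexAction.L {V : Type u} {W : Type w} [AddCommGroup V] [Module ℂ V]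
    [AddCommGroup W] [Module ℂ W] (Y : VertexAction V W) (ω : V) (n : ℤ) : Module.End ℂ W :=
  Y.mode ω (n + 1)

/-- The Virasoro relations with central charge `c`. -/
def VertexAction.Virasoro {V : Type u} {W : Type w} [AddCommGroup V] [Module ℂ V]
    [AddCommGroup W] [Module ℂ W] (Y : VertexAction V W) (ω : V) (c : ℂ) : Prop :=
  ∀ m n : ℤ, Y.L ω m * Y.L ω n - Y.L ω n * Y.L ω m =
    ((m - n : ℤ) : ℂ) • Y.L ω (m + n) +
      (if m + n = 0 then (1 / 12 : ℂ) * ((m ^ 3 - m : ℤ) : ℂ) * c else 0) • (1 : Module.End ℂ W)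

/-- The Jacobi identity
`x₀⁻¹ δ((x₁-x₂)/x₀) Y₃(v,x₁) I(a,x₂) b - x₀⁻¹ δ((x₂-x₁)/(-x₀)) I(a,x₂) Y₂(v,x₁) b`
`= x₂⁻¹ δ((x₁-x₀)/x₂) I(Y₁(v,x₀)a,x₂) b`
for `I(a,x) b = ∑ₙ (I a b n) x^(-n-1)`, written as the equality of the coefficients of
`x₀^(-l-1) x₁^(-m-1) x₂^(-n-1)`. The index `n` runs over `ι = ℤ` for vertex operators and over
`ι = ℂ` for intertwining operators. All sums have finite support if `I` is lower truncated. -/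
def JacobiIdentity {V : Type*} {W₁ W₂ W₃ ι : Type*} [AddCommGroup V] [Module ℂ V]
    [AddCommGroup W₁] [Module ℂ W₁] [AddCommGroup W₂] [Module ℂ W₂]
    [AddCommGroup W₃] [Module ℂ W₃] [Ring ι]
    (Y₁ : VertexAction V W₁) (Y₂ : VertexAction V W₂) (Y₃ : VertexAction V W₃)
    (I : W₁ → W₂ → ι → W₃) : Prop :=
  ∀ (v : V) (a : W₁) (b : W₂) (l m : ℤ) (n : ι),
    (∑ᶠ i : ℕ, ((-1) ^ i * Ring.choose l i : ℤ) • Y₃.mode v (m + l - i) (I a b (n + i))) -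
      (∑ᶠ i : ℕ, ((l.negOnePow : ℤ) * (-1) ^ i * Ring.choose l i : ℤ) •
        I a (Y₂.mode v (m + i) b) (n + (l : ι) - i)) =
    ∑ᶠ i : ℕ, (Ring.choose m i : ℤ) • I (Y₁.mode v (l + i) a) b ((m : ι) + n - i)

/-- `M = ∐ᵢ f i` as a vector space. -/
def IsGrading {M ι : Type*} [AddCommGroup M] [Module ℂ M] (f : ι → Submodule ℂ M) : Prop :=
  iSupIndep f ∧ ⨆ i, f i = ⊤

/-- Conformal vertex algebras. -/
structure ConformalVertexAlgebra (V : Type u) [AddCommGroup V] [Module ℂ V] where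
  Y : VertexAction V V
  /-- the weight space `V_(n)` -/
  wt : ℤ → Submodule ℂ V
  vac : V
  ω : V
  /-- the central charge -/
  c : ℂ
  wt_grading : IsGrading wt
  vac_mem : vac ∈ wt 0
  ω_mem : ω ∈ wt 2
  vacuum : ∀ n : ℤ, Y.mode vac n = if n = -1 then 1 else 0
  creation : ∀ (v : V) (n : ℤ), 0 ≤ n → Y.mode v n vac = 0
  creation_lim : ∀ v : V, Y.mode v (-1) vac = v
  jacobi : JacobiIdentity Y Y Y (fun a b (n : ℤ) => Y.mode a n b)
  virasoro : Y.Virasoro ω c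
  derivative : ∀ (v : V) (n : ℤ), Y.mode (Y.L ω (-1) v) n = (-n : ℂ) • Y.mode v (n - 1)
  L_zero : ∀ (n : ℤ), ∀ v ∈ wt n, Y.L ω 0 v = (n : ℂ) • v

/-- Generalized modules for a conformal vertex algebra. -/
structure GeneralizedModule {V : Type u} [AddCommGroup V] [Module ℂ V]
    (X : ConformalVertexAlgebra V) (W : Type w) [AddCommGroup W] [Module ℂ W] where
  Y : VertexAction V W
  /-- the generalized weight space `W_[n]` -/
  wt : ℂ → Submodule ℂ W
  wt_grading : IsGrading wt
  vacuum : ∀ n : ℤ, Y.mode X.vac n = if n = -1 then 1 else 0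
  jacobi : JacobiIdentity X.Y Y Y (fun a b (n : ℤ) => Y.mode a n b)
  virasoro : Y.Virasoro X.ω X.c
  derivative : ∀ (v : V) (n : ℤ), Y.mode (X.Y.L X.ω (-1) v) n = (-n : ℂ) • Y.mode v (n - 1)
  L_zero : ∀ (n : ℂ), ∀ x ∈ wt n, ∃ k : ℕ, ((Y.L X.ω 0 - n • (1 : Module.End ℂ W)) ^ k) x = 0

/-- Strongly `A`-graded conformal vertex algebras. -/
structure StronglyGradedVA (A : Type v) [AddCommGroup A] (V : Type u) [AddCommGroup V]
    [Module ℂ V] extends ConformalVertexAlgebra V where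
  /-- the homogeneous subspace `V^(α)` -/
  gr : A → Submodule ℂ V
  gr_grading : IsGrading gr
  compatible : ∀ α, gr α = ⨆ n, wt n ⊓ gr α
  lower : ∀ α, ∃ N : ℤ, ∀ n < N, wt n ⊓ gr α = ⊥
  finite : ∀ α n, FiniteDimensional ℂ ↥(wt n ⊓ gr α)
  vac_gr : vac ∈ gr 0
  ω_gr : ω ∈ gr 0
  mode_gr : ∀ (α β : A), ∀ v ∈ gr α, ∀ (l : ℤ), ∀ x ∈ gr β, Y.mode v l x ∈ gr (α + β)

/-- Generalized modules for a strongly `A`-graded conformal vertex algebra that are strongly graded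
with respect to the abelian group `Γ`, which contains `A` as a subgroup. -/
structure StronglyGradedModule {Γ : Type v} [AddCommGroup Γ] {A : AddSubgroup Γ}
    {V : Type u} [AddCommGroup V] [Module ℂ V] (X : StronglyGradedVA A V)
    (W : Type w) [AddCommGroup W] [Module ℂ W]
    extends GeneralizedModule X.toConformalVertexAlgebra W where
  /-- the homogeneous subspace `W^(β)` -/
  gr : Γ → Submodule ℂ W
  gr_grading : IsGrading gr
  compatible : ∀ β, gr β = ⨆ n, wt n ⊓ gr β
  lower : ∀ (β : Γ) (n : ℂ), ∃ N : ℤ, ∀ k < N, wt (n + (k : ℂ)) ⊓ gr β = ⊥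
  finite : ∀ (β : Γ) (n : ℂ), FiniteDimensional ℂ ↥(wt n ⊓ gr β)
  mode_gr : ∀ (α : A) (β : Γ), ∀ v ∈ X.gr α, ∀ (l : ℤ), ∀ x ∈ gr β,
    Y.mode v l x ∈ gr ((α : Γ) + β)

/-- `V₀` is a vertex subalgebra of `V` graded by weights and by the subgroup `A₀` of `A`:
`V₀ = ∐ V₀ ∩ V_(n) ∩ V^(α)` over `n ∈ ℤ` and `α ∈ A₀`. The lower truncation and the finite dimension
of the doubly homogeneous subspaces are inherited from `V`. -/
structure StronglyGradedVA.IsGradedSubalgebra {Γ : Type v} [AddCommGroup Γ] {A : AddSubgroup Γ}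
    {V : Type u} [AddCommGroup V] [Module ℂ V] (X : StronglyGradedVA A V)
    (A₀ : AddSubgroup Γ) (V₀ : Submodule ℂ V) : Prop where
  le : A₀ ≤ A
  vac_mem : X.vac ∈ V₀
  mode_mem : ∀ a ∈ V₀, ∀ b ∈ V₀, ∀ n : ℤ, X.Y.mode a n b ∈ V₀
  graded : V₀ = ⨆ (α : A) (_ : (α : Γ) ∈ A₀) (n : ℤ), V₀ ⊓ X.wt n ⊓ X.gr α

namespace StronglyGradedModule

variable {Γ : Type v} [AddCommGroup Γ] {A : AddSubgroup Γ} {V : Type u} [AddCommGroup V]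
  [Module ℂ V] {X : StronglyGradedVA A V} {W : Type w} [AddCommGroup W] [Module ℂ W]

/-- All generalized weights are real. -/
def IsRealGraded (S : StronglyGradedModule X W) : Prop :=
  ∀ n : ℂ, n.im ≠ 0 → S.wt n = ⊥

/-- Lower bounded strongly graded generalized modules. -/
def IsLowerBounded (S : StronglyGradedModule X W) : Prop :=
  ∀ β : Γ, ∃ N : ℝ, ∀ n : ℂ, n.re < N → S.wt n ⊓ S.gr β = ⊥

/-- `C₁(W)`, with respect to `V₀`: the span of the elements `u_{-1} x` with `x ∈ W` and
`u ∈ (V₀)₊ = ∐_{n > 0} (V₀)_(n)`. -/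
def C₁ (S : StronglyGradedModule X W) (V₀ : Submodule ℂ V) : Submodule ℂ W :=
  Submodule.span ℂ {y | ∃ u ∈ ⨆ (n : ℤ) (_ : 0 < n), V₀ ⊓ X.wt n, ∃ x : W, y = S.Y.mode u (-1) x}

/-- `C₁`-cofiniteness as a `V₀`-module: every `W^(β) / (C₁(W) ∩ W^(β))` is finite-dimensional. -/
def IsC₁Cofinite (S : StronglyGradedModule X W) (V₀ : Submodule ℂ V) : Prop :=
  ∀ β : Γ, FiniteDimensional ℂ (↥(S.gr β) ⧸ (S.C₁ V₀).submoduleOf (S.gr β))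

/-- The homogeneous subspace `(W')^(β) = ∐ₙ (W^(-β)_[n])^*` of the graded dual `W' ⊆ W^*`, the
underlying space of the contragredient module. Here `(W^(-β)_[n])^*` consists of the linear
functionals that vanish on all doubly homogeneous subspaces of `W` other than `W^(-β)_[n]`. -/
def contragredientGr (S : StronglyGradedModule X W) (β : Γ) : Submodule ℂ (Module.Dual ℂ W) :=
  ⨆ n : ℂ, ⨅ (γ : Γ) (m : ℂ) (_ : ¬(γ = -β ∧ m = n)), (S.wt m ⊓ S.gr γ).dualAnnihilator

/-- `W^(β)` as a `V^(0)`-module: the modes of the elements of `V^(0)`, restricted to `W^(β)`. -/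
def homogeneousAction (S : StronglyGradedModule X W) (β : Γ) :
    VertexAction ↥(X.gr 0) ↥(S.gr β) where
  mode :=
    { toFun := fun u n => (S.Y.mode u n).restrict (p := S.gr β) (q := S.gr β)
        (fun x hx => by simpa using S.mode_gr 0 β u u.2 n x hx)
      map_add' := fun a b => by
        funext n
        ext x
        simp [LinearMap.restrict_apply]
      map_smul' := fun r a => by
        funext n
        ext x
        simp [LinearMap.restrict_apply] }
  truncation := fun u x => by
    obtain ⟨N, hN⟩ := S.Y.truncation (u : V) (x : W)
    exact ⟨N, fun n hn => Subtype.ext (by simpa [LinearMap.restrict_apply] using hN n hn)⟩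

end StronglyGradedModule

/-- Linear maps `W₁ ⊗ W₂ → W₃[log x]{x}`. The coefficient of `x^(-n-1) (log x)^k` in `𝒴(a,x)b` is
`𝒴 a b n k`; for each `n ∈ ℂ` only finitely many `k` occur. -/
abbrev LogMap (W₁ W₂ W₃ : Type*) [AddCommGroup W₁] [Module ℂ W₁] [AddCommGroup W₂] [Module ℂ W₂]
    [AddCommGroup W₃] [Module ℂ W₃] :=
  W₁ →ₗ[ℂ] W₂ →ₗ[ℂ] (ℂ → (ℕ →₀ W₃))

/-- Logarithmic intertwining operators of type `W₃` over `W₁ W₂`, for the vertex operators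
`Y₁`, `Y₂`, `Y₃` and the conformal vector `ω`. The last field is the equality of the coefficients
of `x^(-n-1) (log x)^k` in `𝒴(L(-1)a, x)b = (d/dx) 𝒴(a, x)b`. -/
structure IsLogIntertwining {V W₁ W₂ W₃ : Type*} [AddCommGroup V] [Module ℂ V]
    [AddCommGroup W₁] [Module ℂ W₁] [AddCommGroup W₂] [Module ℂ W₂]
    [AddCommGroup W₃] [Module ℂ W₃] (ω : V)
    (Y₁ : VertexAction V W₁) (Y₂ : VertexAction V W₂) (Y₃ : VertexAction V W₃)
    (𝒴 : LogMap W₁ W₂ W₃) : Prop where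
  truncation : ∀ (a : W₁) (b : W₂) (n : ℂ), ∃ N : ℕ, ∀ m ≥ N, ∀ k : ℕ, 𝒴 a b (n + (m : ℂ)) k = 0
  jacobi : ∀ k : ℕ, JacobiIdentity Y₁ Y₂ Y₃ (fun a b (n : ℂ) => 𝒴 a b n k)
  derivative : ∀ (a : W₁) (b : W₂) (n : ℂ) (k : ℕ), 𝒴 (Y₁.L ω (-1) a) b n k =
    (-n) • 𝒴 a b (n - 1) k + ((k : ℂ) + 1) • 𝒴 a b (n - 1) (k + 1)

/-- Compatibility of an operator of type `W₃` over `W₁ W₂` with the second gradings. -/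
def IsGradingCompatible {Γ : Type*} [AddCommGroup Γ] {A : AddSubgroup Γ} {V : Type*}
    [AddCommGroup V] [Module ℂ V] {X : StronglyGradedVA A V} {W₁ W₂ W₃ : Type*}
    [AddCommGroup W₁] [Module ℂ W₁] [AddCommGroup W₂] [Module ℂ W₂]
    [AddCommGroup W₃] [Module ℂ W₃] (S₁ : StronglyGradedModule X W₁)
    (S₂ : StronglyGradedModule X W₂) (S₃ : StronglyGradedModule X W₃)
    (𝒴 : LogMap W₁ W₂ W₃) : Prop :=
  ∀ β γ : Γ, ∀ a ∈ S₁.gr β, ∀ b ∈ S₂.gr γ, ∀ (n : ℂ) (k : ℕ), 𝒴 a b n k ∈ S₃.gr (β + γ)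

/-- The vector space of logarithmic intertwining operators of a given type. -/
def logIntertwiningSpace {V W₁ W₂ W₃ : Type*} [AddCommGroup V] [Module ℂ V]
    [AddCommGroup W₁] [Module ℂ W₁] [AddCommGroup W₂] [Module ℂ W₂]
    [AddCommGroup W₃] [Module ℂ W₃] (ω : V)
    (Y₁ : VertexAction V W₁) (Y₂ : VertexAction V W₂) (Y₃ : VertexAction V W₃) :
    Submodule ℂ (LogMap W₁ W₂ W₃) where
  carrier := {𝒴 | IsLogIntertwining ω Y₁ Y₂ Y₃ 𝒴}
  zero_mem' := by
    refine ⟨fun a b n => ⟨0, fun m _ k => by simp⟩, fun k v a b l m n => by simp,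
      fun a b n k => by simp⟩
  add_mem' := by
    rintro P Q hP hQ
    refine ⟨fun a b n => ?_, fun k v a b l m n => ?_, fun a b n k => ?_⟩
    · obtain ⟨N₁, h₁⟩ := hP.truncation a b n
      obtain ⟨N₂, h₂⟩ := hQ.truncation a b n
      refine ⟨max N₁ N₂, fun m hm k => ?_⟩
      have e₁ := h₁ m (le_trans (le_max_left _ _) hm) k
      have e₂ := h₂ m (le_trans (le_max_right _ _) hm) k
      simp [e₁, e₂]
    · have key : ∀ (f : ℕ → W₃) (N : ℕ), (∀ i ≥ N, f i = 0) → f.support.Finite :=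
        fun f N hf => (Set.finite_lt_nat N).subset fun i hi => by
          by_contra hc
          exact hi (hf i (not_lt.mp hc))
      have f₁ : ∀ R : LogMap W₁ W₂ W₃, IsLogIntertwining ω Y₁ Y₂ Y₃ R →
          (fun i : ℕ => ((-1) ^ i * Ring.choose l i : ℤ) •
            Y₃.mode v (m + l - i) (R a b (n + i) k)).support.Finite := by
        intro R hR
        obtain ⟨N, hN⟩ := hR.truncation a b n
        exact key _ N fun i hi => by simp [hN i hi k]
      have f₂ : ∀ R : LogMap W₁ W₂ W₃,
          (fun i : ℕ => ((l.negOnePow : ℤ) * (-1) ^ i * Ring.choose l i : ℤ) •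
            R a (Y₂.mode v (m + i) b) (n + (l : ℂ) - i) k).support.Finite := by
        intro R
        obtain ⟨N, hN⟩ := Y₂.truncation v b
        refine key _ (N - m).toNat fun i hi => ?_
        simp [hN (m + i) (by lia)]
      have f₃ : ∀ R : LogMap W₁ W₂ W₃,
          (fun i : ℕ => (Ring.choose m i : ℤ) •
            R (Y₁.mode v (l + i) a) b ((m : ℂ) + n - i) k).support.Finite := by
        intro R
        obtain ⟨N, hN⟩ := Y₁.truncation v a
        refine key _ (N - l).toNat fun i hi => ?_
        simp [hN (l + i) (by lia)]
      have eP := hP.jacobi k v a b l m n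
      have eQ := hQ.jacobi k v a b l m n
      simp only [LinearMap.add_apply, Pi.add_apply, Finsupp.add_apply, map_add, smul_add]
      rw [finsum_add_distrib (f₁ P hP) (f₁ Q hQ), finsum_add_distrib (f₂ P) (f₂ Q),
        finsum_add_distrib (f₃ P) (f₃ Q), ← eP, ← eQ]
      abel
    · have eP := hP.derivative a b n k
      have eQ := hQ.derivative a b n k
      simp only [LinearMap.add_apply, Pi.add_apply, Finsupp.add_apply, smul_add, eP, eQ]
      abel
  smul_mem' := by
    rintro r P hP
    refine ⟨fun a b n => ?_, fun k v a b l m n => ?_, fun a b n k => ?_⟩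
    · obtain ⟨N, h⟩ := hP.truncation a b n
      exact ⟨N, fun m hm k => by simp [h m hm k]⟩
    · have eP := hP.jacobi k v a b l m n
      simp only [LinearMap.smul_apply, Pi.smul_apply, Finsupp.smul_apply, map_smul,
        smul_comm _ r, ← smul_finsum]
      rw [← smul_sub, eP]
    · have eP := hP.derivative a b n k
      simp only [LinearMap.smul_apply, Pi.smul_apply, Finsupp.smul_apply, eP, smul_add,
        smul_comm r]

/-- The fusion rule of type `M₃^(b₁+b₂)` over `M₁^(b₁) M₂^(b₂)`: the dimension of the space of
logarithmic intertwining operators among these homogeneous subspaces, viewed as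
`V^(0)`-modules. -/
def fusionRule {Γ : Type v} [AddCommGroup Γ] {A : AddSubgroup Γ} {V : Type u}
    [AddCommGroup V] [Module ℂ V] {X : StronglyGradedVA A V} {M₁ M₂ M₃ : Type w}
    [AddCommGroup M₁] [Module ℂ M₁] [AddCommGroup M₂] [Module ℂ M₂]
    [AddCommGroup M₃] [Module ℂ M₃] (S₁ : StronglyGradedModule X M₁)
    (S₂ : StronglyGradedModule X M₂) (S₃ : StronglyGradedModule X M₃) (b₁ b₂ : Γ) : Cardinal :=
  Module.rank ℂ (logIntertwiningSpace (⟨X.ω, X.ω_gr⟩ : X.gr 0) (S₁.homogeneousAction b₁)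
    (S₂.homogeneousAction b₂) (S₃.homogeneousAction (b₁ + b₂)))

/-- Formal series in complex powers and nonnegative integral powers of the logarithms of
`z₁, …, zₙ`: `φ p k` is the coefficient of `∏ᵢ zᵢ^(pᵢ) (log zᵢ)^(kᵢ)`. -/
abbrev FormalLogSeries (n : ℕ) := (Fin n → ℂ) → (Fin n → ℕ) → ℂ

/-- The formal partial derivative `∂/∂z_l`, determined by
`(d/dz) (z^q (log z)^j) = q z^(q-1) (log z)^j + j z^(q-1) (log z)^(j-1)`. -/
def FormalLogSeries.partialDeriv {n : ℕ} (l : Fin n) (φ : FormalLogSeries n) :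
    FormalLogSeries n := fun p k =>
  (p l + 1) * φ (p + Pi.single l 1) k + ((k l : ℂ) + 1) * φ (p + Pi.single l 1) (k + Pi.single l 1)

/-- The product of the Laurent series `∑_q c_q z^q` and `φ`. -/
def FormalLogSeries.laurentMul {n : ℕ} (c : (Fin n → ℤ) → ℂ) (φ : FormalLogSeries n) :
    FormalLogSeries n := fun p k =>
  ∑ᶠ q : Fin n → ℤ, c q * φ (fun i => p i - (q i : ℂ)) k

/-- The points of `ℂⁿ` with nonzero and pairwise distinct coordinates. -/
def ConfigurationSpace (n : ℕ) : Set (Fin n → ℂ) :=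
  {z | (∀ i, z i ≠ 0) ∧ ∀ i j, i ≠ j → z i ≠ z j}

/-- The ring `ℂ[z₁^{±1}, …, zₙ^{±1}, (z₁ - z₂)⁻¹, (z₁ - z₃)⁻¹, …, (z_{n-1} - zₙ)⁻¹]`, as a ring of
functions on the set on which its elements are defined. -/
def coefficientRing (n : ℕ) : Subalgebra ℂ (ConfigurationSpace n → ℂ) :=
  Algebra.adjoin ℂ
    ({f | ∃ i, f = fun z => z.1 i} ∪ {f | ∃ i, f = fun z => (z.1 i)⁻¹} ∪
      {f | ∃ i j, i < j ∧ f = fun z => (z.1 i - z.1 j)⁻¹})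

/-- `∑_q c_q z^q` is the expansion of `a` as a Laurent series in the region
`|z₁| > ⋯ > |zₙ| > 0`. -/
def IsExpansion {n : ℕ} (a : ConfigurationSpace n → ℂ) (c : (Fin n → ℤ) → ℂ) : Prop :=
  ∀ z : ConfigurationSpace n, (∀ i j, i < j → ‖z.1 j‖ < ‖z.1 i‖) →
    HasSum (fun q : Fin n → ℤ => c q * ∏ i, z.1 i ^ q i) (a z)

/-- The series `⟨f, 𝒴₁(x₁, z₁) ⋯ 𝒴ₙ(xₙ, zₙ) y⟩` for operators `𝒴ᵢ` of type `U_{i-1}` over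
`Wᵢ Uᵢ`, for `xᵢ ∈ Wᵢ`, for `y ∈ Uₙ` and for a linear functional `f` on `U₀`. -/
def matrixElement {n : ℕ} {W : Fin n → Type w} {U : Fin (n + 1) → Type w}
    [∀ i, AddCommGroup (W i)] [∀ i, Module ℂ (W i)]
    [∀ i, AddCommGroup (U i)] [∀ i, Module ℂ (U i)]
    (𝒴 : ∀ i : Fin n, LogMap (W i) (U i.succ) (U i.castSucc))
    (f : Module.Dual ℂ (U 0)) (x : ∀ i, W i) (y : U (Fin.last n)) : FormalLogSeries n :=
  fun p k => f (Fin.reverseInduction (motive := fun i => U i) y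
    (fun i b => 𝒴 i (x i) b (-(p i) - 1) (k i)) 0)

end

/-!
The matrix elements `⟨f, 𝒴₁(x₁, z₁) ⋯ 𝒴ₙ(xₙ, zₙ) y⟩` that are related to a given one lie in a
finitely generated module over the Noetherian ring `R = ℂ[zᵢ^{±1}, (zᵢ - zⱼ)⁻¹]`. By
`L(-1)`-derivativity (`partialDeriv_matrixElement`) the derivatives of a matrix element are again
such matrix elements, so that the ascending chain of the submodules generated by the derivatives
of order less than `m` stabilizes, which is a monic differential equation for each variable
(`exists_laurentMul_recurrence`).

*Finite generation* (`exists_fg_allMemBelow`). Consider all homogeneous `x₁, …, xₙ, y` with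
degrees in the cosets `βᵢ + A₀` and `γ + A₀`. A nonzero matrix element makes every `𝒴ᵢ` restrict
to a nonzero operator between homogeneous subspaces, so that by the finiteness of the fusion rules
only finitely many tuples of degrees matter (`finite_degrees`). For each of them `C₁`-cofiniteness
provides finitely many vectors that span every slot modulo elements `u_{-1} w` with `u ∈ V₀` of
positive weight (`exists_finite_generators`). The Jacobi identity moves `u_{-1}` from one slot to
the others, with coefficients in `R` (`matrixElement_last_mode_mem`,
`matrixElement_update_mode_mem`); the new matrix elements have smaller total weight, and the
degrees stay in the same cosets. Total weights of nonzero matrix elements are bounded below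
(`exists_le_total_weight`), so the reduction ends with the chosen spanning vectors. When `u` acts
on the functional `f`, only the weight of `f` is used: it drops by an integer, and for each tuple
of degrees only finitely many of these weights occur in the target (`finite_weights`). Hence no
module structure on the graded dual is needed.

*Formal series.* For products of series to make sense, exponents are recorded through their tail
sums `∑_{j ≥ i} q_j`, which are bounded below both for matrix elements
(`isTailBounded_matrixElement`) and for expansions in `|z₁| > ⋯ > |zₙ| > 0`. Laurent series become
Hahn series over `ℤⁿ` (`TailSeries`), `R` becomes a finitely generated subalgebra of them
(`expansionRing`), and a formal series with complex exponents and logarithms becomes a family of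
Hahn series indexed by base points in `ℂⁿ` and by the powers of the logarithms (`SeriesFamily`,
`realizedBy`). These families form a genuine `R`-module.
-/

/-! ### Laurent expansions as Hahn series -/

/-- The matrix of the tail sums `∑_{j ≥ i} q_j`. -/
def tailMatrix (n : ℕ) : Matrix (Fin n) (Fin n) ℤ := Matrix.of fun i j => if i ≤ j then 1 else 0

theorem isUnit_tailMatrix (n : ℕ) : IsUnit (tailMatrix n) := by
  rw [Matrix.isUnit_iff_isUnit_det, Matrix.det_of_isUpperTriangular]
  · simp [tailMatrix]
  · intro i j hij
    have : ¬ i ≤ j := not_le.mpr hij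
    simp [tailMatrix, this]

/-- The automorphism `q ↦ (∑_{j ≥ i} q_j)_i` of `ℤⁿ`. -/
noncomputable def tailSum (n : ℕ) : (Fin n → ℤ) ≃+ (Fin n → ℤ) :=
  AddEquiv.ofBijective (tailMatrix n).mulVecLin.toAddMonoidHom
    ⟨Matrix.mulVec_injective_of_isUnit (isUnit_tailMatrix n),
      Matrix.mulVec_surjective_iff_isUnit.mpr (isUnit_tailMatrix n)⟩

theorem tailSum_apply {n : ℕ} (q : Fin n → ℤ) (i : Fin n) :
    tailSum n q i = ∑ j ∈ Finset.Ici i, q j := by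
  change (tailMatrix n).mulVec q i = _
  simp only [Matrix.mulVec, dotProduct, tailMatrix, Matrix.of_apply, ite_mul, one_mul, zero_mul]
  rw [← Finset.sum_filter]
  refine Finset.sum_congr ?_ fun _ _ => rfl
  ext j
  simp

theorem isPWO_of_bddBelow {n : ℕ} {s : Set (Fin n → ℤ)} (C : ℤ)
    (h : ∀ q ∈ s, ∀ i, C ≤ q i) : s.IsPWO := by
  have hpi : (Set.univ.pi fun _ : Fin n => Set.Ici C).IsPWO :=
    Set.IsPWO.pi fun i => (BddBelow.isWF ⟨C, fun _ h => h⟩).isPWO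
  exact hpi.mono fun q hq i _ => h q hq i

/-- Formal Laurent series in `n` variables whose exponents, in the coordinates `tailSum`, form a
partially well-ordered set. The expansions of the elements of `coefficientRing n` in
`|z₁| > ⋯ > |zₙ| > 0` are of this kind. -/
abbrev TailSeries (n : ℕ) : Type := HahnSeries (Fin n → ℤ) ℂ

namespace TailSeries

variable {n : ℕ}

/-- The coefficients of a series, as a function of the exponents of the monomials. -/
noncomputable def laurentCoeff (h : TailSeries n) (q : Fin n → ℤ) : ℂ := h.coeff (tailSum n q)

/-- The Laurent monomial `r z^q`. -/
noncomputable def monomial (q : Fin n → ℤ) (r : ℂ) : TailSeries n :=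
  HahnSeries.single (tailSum n q) r

theorem laurentCoeff_monomial (q s : Fin n → ℤ) (r : ℂ) :
    (monomial q r).laurentCoeff s = if s = q then r else 0 := by
  classical
  simp only [laurentCoeff, monomial, HahnSeries.coeff_single, EmbeddingLike.apply_eq_iff_eq]

theorem laurentCoeff_monomial_mul (q s : Fin n → ℤ) (r : ℂ) (h : TailSeries n) :
    (monomial q r * h).laurentCoeff s = r * h.laurentCoeff (s - q) := by
  simp only [laurentCoeff, monomial, HahnSeries.coeff_single_mul, map_sub]

theorem finite_support_mul (h g : TailSeries n) (s : Fin n → ℤ) :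
    (Function.support fun q => h.laurentCoeff q * g.laurentCoeff (s - q)).Finite := by
  classical
  refine ((Finset.antidiagonal h.isPWO_support g.isPWO_support (tailSum n s)).image
    fun x => (tailSum n).symm x.1).finite_toSet.subset fun q hq => ?_
  rw [Function.mem_support] at hq
  rw [Finset.mem_coe, Finset.mem_image]
  exact ⟨(tailSum n q, tailSum n (s - q)), Finset.mem_antidiagonal.mpr
    ⟨left_ne_zero_of_mul hq, right_ne_zero_of_mul hq, by simp⟩, by simp⟩

theorem laurentCoeff_mul (h g : TailSeries n) (s : Fin n → ℤ) :
    (h * g).laurentCoeff s = ∑ᶠ q, h.laurentCoeff q * g.laurentCoeff (s - q) := by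
  classical
  rw [laurentCoeff, HahnSeries.coeff_mul, finsum_eq_sum_of_support_subset (s :=
    (Finset.antidiagonal h.isPWO_support g.isPWO_support (tailSum n s)).image
      fun x => (tailSum n).symm x.1)]
  · rw [Finset.sum_image]
    · refine Finset.sum_congr rfl fun ij hij => ?_
      have h1 := (Finset.mem_antidiagonal.mp hij).2.2
      simp only [laurentCoeff, map_sub, AddEquiv.apply_symm_apply]
      rw [← h1, add_sub_cancel_left]
    · intro a ha b hb hab
      have h1 := (Finset.mem_antidiagonal.mp ha).2.2
      have h2 := (Finset.mem_antidiagonal.mp hb).2.2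
      have h3 : a.1 = b.1 := (tailSum n).symm.injective hab
      rw [← h2, h3] at h1
      exact Prod.ext h3 (add_left_cancel h1)
  · intro q hq
    rw [Function.mem_support] at hq
    rw [Finset.mem_coe, Finset.mem_image]
    exact ⟨(tailSum n q, tailSum n (s - q)), Finset.mem_antidiagonal.mpr
      ⟨left_ne_zero_of_mul hq, right_ne_zero_of_mul hq, by simp⟩, by simp⟩

end TailSeries

/-- The sum of a finitely supported convolution is the product of the sums. -/
theorem hasSum_finsum_convolution {G : Type*} [AddCommGroup G] {f g : G → ℂ} {a b : ℂ}
    (hf : HasSum f a) (hg : HasSum g b)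
    (hfin : ∀ s, (Function.support fun q => f q * g (s - q)).Finite) :
    HasSum (fun s => ∑ᶠ q, f q * g (s - q)) (a * b) := by
  have h3 := hf.mul hg (summable_mul_of_summable_norm hf.summable.norm hg.summable.norm)
  let e : G × G ≃ G × G :=
    { toFun := fun s => (s.2, s.1 - s.2)
      invFun := fun s => (s.1 + s.2, s.1)
      left_inv := fun s => by simp
      right_inv := fun s => by simp }
  refine HasSum.prod_fiberwise ((e.hasSum_iff).mpr h3) fun s => ?_
  rw [finsum_eq_sum _ (hfin s)]
  exact hasSum_sum_of_ne_finset_zero fun q hq => by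
    by_contra hc
    exact hq ((hfin s).mem_toFinset.mpr hc)

namespace IsExpansion

variable {n : ℕ} {a b : ConfigurationSpace n → ℂ} {g h : TailSeries n}

theorem monomial (q : Fin n → ℤ) (r : ℂ) :
    IsExpansion (fun z : ConfigurationSpace n => r * ∏ i, z.1 i ^ q i)
      (TailSeries.monomial q r).laurentCoeff := by
  intro z _
  convert hasSum_ite_eq q (r * ∏ i, z.1 i ^ q i) using 1
  funext s
  rw [TailSeries.laurentCoeff_monomial]
  split_ifs with hs <;> simp [hs]

theorem add (ha : IsExpansion a g.laurentCoeff) (hb : IsExpansion b h.laurentCoeff) :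
    IsExpansion (a + b) (g + h).laurentCoeff := by
  intro z hz
  convert (ha z hz).add (hb z hz) using 1
  funext s
  · simp [TailSeries.laurentCoeff, add_mul]
  · rfl

theorem mul (ha : IsExpansion a g.laurentCoeff) (hb : IsExpansion b h.laurentCoeff) :
    IsExpansion (a * b) (g * h).laurentCoeff := by
  intro z hz
  have key := hasSum_finsum_convolution (ha z hz) (hb z hz) fun s =>
    (TailSeries.finite_support_mul g h s).subset fun q hq hc => hq (by
      dsimp only at hc ⊢
      rw [mul_mul_mul_comm, hc, zero_mul])
  rw [Pi.mul_apply]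
  refine Eq.mpr (congrArg (HasSum · _) (funext fun s => ?_)) key
  rw [TailSeries.laurentCoeff_mul, finsum_mul]
  refine finsum_congr fun q => ?_
  have : ∏ i, z.1 i ^ s i = (∏ i, z.1 i ^ q i) * ∏ i, z.1 i ^ (s - q) i := by
    rw [← Finset.prod_mul_distrib]
    refine Finset.prod_congr rfl fun i _ => ?_
    rw [← zpow_add₀ (z.2.1 i)]
    simp
  rw [this]
  ring

end IsExpansion

/-! ### The expansion of `(zᵢ - zⱼ)⁻¹` -/

namespace TailSeries

variable {n : ℕ}

/-- The exponent of `z_j / z_i` is positive in the coordinates `tailSum`. -/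
theorem tailSum_single_sub_single {i j : Fin n} (hij : i < j) :
    0 < tailSum n (Pi.single j 1 - Pi.single i 1) := by
  classical
  have hne : tailSum n (Pi.single j 1 - Pi.single i 1) ≠ 0 := by
    rw [Ne, EmbeddingLike.map_eq_zero_iff, sub_eq_zero]
    intro h
    have := congrFun h j
    simp [hij.ne'] at this
  refine lt_of_le_of_ne (fun k => ?_) hne.symm
  rw [tailSum_apply, Pi.zero_apply]
  simp only [Pi.sub_apply, Finset.sum_sub_distrib, Pi.single_apply, Finset.sum_ite_eq',
    Finset.mem_Ici]
  split_ifs with h1 h2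
  · simp
  · simp
  · exact absurd (by lia) h1
  · simp

/-- The exponents of the powers of `z_j / z_i`. -/
noncomputable def ratioHom {i j : Fin n} (_ : i < j) : ℕ →+ (Fin n → ℤ) :=
  multiplesHom _ (tailSum n (Pi.single j 1 - Pi.single i 1))

theorem ratioHom_apply {i j : Fin n} (hij : i < j) (k : ℕ) :
    ratioHom hij k = tailSum n (k • (Pi.single j 1 - Pi.single i 1)) := by
  rw [ratioHom, multiplesHom_apply, map_nsmul]

theorem ratioHom_strictMono {i j : Fin n} (hij : i < j) : StrictMono (ratioHom hij) := by
  intro a b hab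
  simpa [ratioHom] using nsmul_lt_nsmul_left (tailSum_single_sub_single hij) hab

/-- Substitution of `z_j / z_i` into a power series. -/
noncomputable def substRatio {i j : Fin n} (hij : i < j) : PowerSeries ℂ →+* TailSeries n :=
  (HahnSeries.embDomainRingHom (ratioHom hij) (ratioHom_strictMono hij).injective
    (fun _ _ => (ratioHom_strictMono hij).le_iff_le)).comp
      (HahnSeries.toPowerSeries (R := ℂ)).symm.toRingHom

theorem laurentCoeff_substRatio {i j : Fin n} (hij : i < j) (f : PowerSeries ℂ) (k : ℕ) :
    (substRatio hij f).laurentCoeff (k • (Pi.single j 1 - Pi.single i 1)) =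
      PowerSeries.coeff k f := by
  rw [laurentCoeff, ← ratioHom_apply hij]
  exact (HahnSeries.embDomain_mk_coeff _ _).trans HahnSeries.coeff_toPowerSeries_symm

theorem laurentCoeff_substRatio_of_notMem {i j : Fin n} (hij : i < j) (f : PowerSeries ℂ)
    (q : Fin n → ℤ) (hq : ∀ k : ℕ, q ≠ k • (Pi.single j 1 - Pi.single i 1)) :
    (substRatio hij f).laurentCoeff q = 0 := by
  refine HahnSeries.embDomain_of_notMem_range ?_
  rintro ⟨k, hk⟩
  refine hq k ((tailSum n).injective ?_)
  rw [← ratioHom_apply hij]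
  exact hk.symm

/-- The expansion of `(z_i - z_j)⁻¹` for `i < j`, in nonnegative powers of `z_j`. -/
noncomputable def invDiff {i j : Fin n} (hij : i < j) : TailSeries n :=
  monomial (-Pi.single i 1) 1 * substRatio hij (PowerSeries.mk 1)

theorem invDiff_pow {i j : Fin n} (hij : i < j) (t : ℕ) :
    invDiff hij ^ (t + 1) = monomial (-((t + 1 : ℕ) • Pi.single i 1)) 1 *
      substRatio hij (PowerSeries.mk fun k => ((t + k).choose t : ℂ)) := by
  rw [invDiff, mul_pow, ← map_pow, PowerSeries.mk_one_pow_eq_mk_choose_add]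
  congr 1
  simp only [monomial, HahnSeries.single_pow, one_pow, map_neg, map_nsmul, smul_neg]

/-- The exponents of the monomials of `(z_i - z_j)^(-t-1)`. -/
theorem sub_exponent_eq {i j : Fin n} (q : Fin n → ℤ) (t k : ℕ) :
    q - -((t + 1 : ℕ) • Pi.single i 1) = k • (Pi.single j 1 - Pi.single i 1) ↔
      q = Pi.single j (k : ℤ) - Pi.single i ((k : ℤ) + t + 1) := by
  have h1 : ∀ (m : ℕ) (l : Fin n), m • (Pi.single l 1 : Fin n → ℤ) = Pi.single l (m : ℤ) := by
    intro m l
    rw [← Pi.single_smul]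
    simp
  rw [smul_sub, h1, h1, h1, Pi.single_add, Pi.single_add]
  push_cast
  rw [Pi.single_add]
  constructor
  · intro h
    rw [← sub_eq_zero] at h ⊢
    rw [← h]
    abel
  · rintro rfl
    abel

theorem exponent_injective {i j : Fin n} (hij : i < j) (t : ℕ) : Function.Injective
    fun k : ℕ => (Pi.single j (k : ℤ) - Pi.single i ((k : ℤ) + t + 1) : Fin n → ℤ) := by
  intro k l h
  have := congrFun h j
  simpa [hij.ne'] using this

theorem laurentCoeff_invDiff_pow {i j : Fin n} (hij : i < j) (t k : ℕ) :
    (invDiff hij ^ (t + 1)).laurentCoeff (Pi.single j (k : ℤ) - Pi.single i ((k : ℤ) + t + 1)) =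
      ((t + k).choose t : ℂ) := by
  rw [invDiff_pow, laurentCoeff_monomial_mul, one_mul, (sub_exponent_eq _ t k).mpr rfl,
    laurentCoeff_substRatio, PowerSeries.coeff_mk]

theorem laurentCoeff_invDiff_pow_of_notMem {i j : Fin n} (hij : i < j) (t : ℕ) (q : Fin n → ℤ)
    (hq : ∀ k : ℕ, q ≠ Pi.single j (k : ℤ) - Pi.single i ((k : ℤ) + t + 1)) :
    (invDiff hij ^ (t + 1)).laurentCoeff q = 0 := by
  rw [invDiff_pow, laurentCoeff_monomial_mul, one_mul, laurentCoeff_substRatio_of_notMem]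
  exact fun k h => hq k ((sub_exponent_eq q t k).mp h)

end TailSeries

theorem IsExpansion.invDiff {n : ℕ} {i j : Fin n} (hij : i < j) :
    IsExpansion (fun z : ConfigurationSpace n => (z.1 i - z.1 j)⁻¹)
      (TailSeries.invDiff hij).laurentCoeff := by
  intro z hz
  have hi : z.1 i ≠ 0 := z.2.1 i
  have hlt : ‖z.1 j / z.1 i‖ < 1 := by
    rw [norm_div, div_lt_one (norm_pos_iff.mpr hi)]
    exact hz i j hij
  rw [← (TailSeries.exponent_injective hij 0).hasSum_iff]
  · have h3 : (z.1 i - z.1 j)⁻¹ = (z.1 i)⁻¹ * (1 - z.1 j / z.1 i)⁻¹ := by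
      rw [← mul_inv, mul_sub, mul_one, mul_div_cancel₀ _ hi]
    dsimp only
    rw [h3]
    refine Eq.mpr (congrArg (HasSum · _) (funext fun k => ?_))
      ((hasSum_geometric_of_norm_lt_one hlt).mul_left (z.1 i)⁻¹)
    have h1 := TailSeries.laurentCoeff_invDiff_pow hij 0 k
    rw [zero_add, pow_one] at h1
    simp only [Function.comp]
    rw [h1]
    have h2 : ∀ l, z.1 l ^ ((Pi.single j (k : ℤ) - Pi.single i ((k : ℤ) + (0 : ℕ) + 1) :
        Fin n → ℤ) l) = (if l = j then z.1 j ^ k else 1) *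
          (if l = i then (z.1 i ^ (k + 1))⁻¹ else 1) := by
      intro l
      rw [Pi.sub_apply, zpow_sub₀ (z.2.1 l), Pi.single_apply, Pi.single_apply, div_eq_mul_inv]
      congr 1
      · split_ifs with h <;> simp [h]
      · split_ifs with h
        · rw [h]
          norm_cast
        · simp
    rw [Finset.prod_congr rfl fun l _ => h2 l, Finset.prod_mul_distrib,
      Finset.prod_ite_eq' , Finset.prod_ite_eq']
    simp only [Finset.mem_univ, if_true, Nat.choose_zero_right, Nat.cast_one, one_mul,
      div_pow]
    field_simp
    ring
  · intro q hq
    have := TailSeries.laurentCoeff_invDiff_pow_of_notMem hij 0 q fun k h => hq ⟨k, h.symm⟩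
    rw [zero_add, pow_one] at this
    rw [this, zero_mul]

/-! ### The coefficient ring as a ring of formal series -/

/-- The formal series that are expansions of the elements of `coefficientRing n`: the algebra
generated by the expansions of `z_i`, `z_i⁻¹` and `(z_i - z_j)⁻¹`. -/
noncomputable def expansionRing (n : ℕ) : Subalgebra ℂ (TailSeries n) :=
  Algebra.adjoin ℂ
    (Set.range (fun i : Fin n => TailSeries.monomial (Pi.single i 1) 1) ∪
      Set.range (fun i : Fin n => TailSeries.monomial (-Pi.single i 1) 1) ∪
      Set.range fun p : {p : Fin n × Fin n // p.1 < p.2} => TailSeries.invDiff p.2)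

instance (n : ℕ) : IsNoetherianRing (expansionRing n) := by
  have : (expansionRing n).FG := Subalgebra.fg_def.mpr ⟨_,
    ((Set.finite_range _).union (Set.finite_range _)).union (Set.finite_range _), rfl⟩
  have : Algebra.FiniteType ℂ (expansionRing n) := (expansionRing n).fg_iff_finiteType.mp this
  exact Algebra.FiniteType.isNoetherianRing ℂ (expansionRing n)

theorem exists_isExpansion_of_mem {n : ℕ} {h : TailSeries n} (hh : h ∈ expansionRing n) :
    ∃ a ∈ coefficientRing n, IsExpansion a h.laurentCoeff := by
  have hmon : ∀ (i : Fin n) (m : ℤ) (z : ConfigurationSpace n),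
      (1 : ℂ) * ∏ l, z.1 l ^ (Pi.single i m : Fin n → ℤ) l = z.1 i ^ m := by
    intro i m z
    rw [one_mul, Finset.prod_eq_single i]
    · simp
    · intro l _ hl
      simp [hl]
    · simp
  induction hh using Algebra.adjoin_induction with
  | mem h hh =>
    rcases hh with (⟨i, rfl⟩ | ⟨i, rfl⟩) | ⟨⟨⟨i, j⟩, hij⟩, rfl⟩
    · refine ⟨_, Algebra.subset_adjoin (Or.inl (Or.inl ⟨i, rfl⟩)), ?_⟩
      have := IsExpansion.monomial (n := n) (Pi.single i 1) 1
      simpa only [hmon, zpow_one] using this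
    · refine ⟨_, Algebra.subset_adjoin (Or.inl (Or.inr ⟨i, rfl⟩)), ?_⟩
      have := IsExpansion.monomial (n := n) (-Pi.single i 1) 1
      dsimp only
      rw [← Pi.single_neg] at this ⊢
      simpa only [hmon, zpow_neg_one] using this
    · exact ⟨_, Algebra.subset_adjoin (Or.inr ⟨i, j, hij, rfl⟩), IsExpansion.invDiff hij⟩
  | algebraMap r =>
    refine ⟨_, Subalgebra.algebraMap_mem _ r, ?_⟩
    have := IsExpansion.monomial (n := n) 0 r
    have h1 : TailSeries.monomial (n := n) 0 r = algebraMap ℂ _ r := by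
      rw [HahnSeries.algebraMap_apply]
      simp [TailSeries.monomial]
    rw [h1] at this
    convert this using 1
    funext z
    simp
  | add g h _ _ hg hh =>
    obtain ⟨a, ha, ha'⟩ := hg
    obtain ⟨b, hb, hb'⟩ := hh
    exact ⟨a + b, add_mem ha hb, ha'.add hb'⟩
  | mul g h _ _ hg hh =>
    obtain ⟨a, ha, ha'⟩ := hg
    obtain ⟨b, hb, hb'⟩ := hh
    exact ⟨a * b, mul_mem ha hb, ha'.mul hb'⟩

/-! ### The module of formal series over the coefficient ring -/

/-- Families of formal Laurent series indexed by the monomials `z^p (log z)^k`. All `p` of a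
coset of `ℤⁿ` in `ℂⁿ` are kept, so that no representatives of the cosets have to be chosen. -/
abbrev SeriesFamily (n : ℕ) : Type := (Fin n → ℂ) → (Fin n → ℕ) → TailSeries n

/-- The family `F` describes `φ` if `F p k` consists of the coefficients of `φ` at the monomials
`z^(p + q) (log z)^k` with `q ∈ ℤⁿ`. -/
def Realizes {n : ℕ} (F : SeriesFamily n) (φ : FormalLogSeries n) : Prop :=
  ∀ p k (q : Fin n → ℤ), (F p k).laurentCoeff q = φ (fun i => p i + (q i : ℂ)) k

namespace Realizes

variable {n : ℕ} {F G : SeriesFamily n} {φ ψ : FormalLogSeries n}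

/-- A formal series is determined by a family that describes it. -/
theorem eq_of (hF : Realizes F φ) (hG : Realizes F ψ) : φ = ψ := by
  funext p k
  simpa using (hF p k 0).symm.trans (hG p k 0)

theorem zero : Realizes (0 : SeriesFamily n) 0 := fun _ _ _ => rfl

theorem add (hF : Realizes F φ) (hG : Realizes G ψ) : Realizes (F + G) (φ + ψ) :=
  fun p k q => congrArg₂ (· + ·) (hF p k q) (hG p k q)

theorem smul (r : ℂ) (hF : Realizes F φ) : Realizes (r • F) (r • φ) :=
  fun p k q => congrArg (r * ·) (hF p k q)

theorem laurentMul (h : TailSeries n) (hF : Realizes F φ) :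
    Realizes (h • F) (FormalLogSeries.laurentMul h.laurentCoeff φ) := by
  intro p k q
  change (h * F p k).laurentCoeff q = _
  rw [TailSeries.laurentCoeff_mul]
  refine finsum_congr fun s => ?_
  rw [hF p k]
  congr 2
  funext i
  simp only [Pi.sub_apply]
  push_cast
  ring

/-- A series whose exponents have tail sums bounded below is described by a family. -/
theorem exists_of_bddBelow (C : ℝ)
    (h : ∀ p k, φ p k ≠ 0 → ∀ i, C ≤ ∑ j ∈ Finset.Ici i, (p j).re) :
    ∃ F, Realizes F φ := by
  have hpwo : ∀ (p : Fin n → ℂ) (k : Fin n → ℕ), (Function.support fun s : Fin n → ℤ =>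
      φ (fun i => p i + (((tailSum n).symm s i : ℤ) : ℂ)) k).IsPWO := by
    intro p k
    obtain ⟨B, hB⟩ := (Set.finite_range fun i => ∑ j ∈ Finset.Ici i, (p j).re).bddAbove
    refine isPWO_of_bddBelow ⌊C - B⌋ fun s hs i => ?_
    have h1 := h _ _ hs i
    simp only [Complex.add_re, Complex.intCast_re, Finset.sum_add_distrib] at h1
    have h2 := hB ⟨i, rfl⟩
    dsimp only at h2
    have h3 := tailSum_apply ((tailSum n).symm s) i
    rw [AddEquiv.apply_symm_apply] at h3
    have h4 : ((s i : ℤ) : ℝ) = ∑ j ∈ Finset.Ici i, (((tailSum n).symm s j : ℤ) : ℝ) := by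
      rw [h3]
      push_cast
      rfl
    have h5 : C - B ≤ s i := by
      rw [h4]
      linarith
    exact_mod_cast (Int.floor_le (C - B)).trans h5
  refine ⟨fun p k => ⟨_, hpwo p k⟩, fun p k q => ?_⟩
  change φ (fun i => p i + (((tailSum n).symm (tailSum n q) i : ℤ) : ℂ)) k = _
  rw [AddEquiv.symm_apply_apply]

end Realizes

/-- The formal series described by the elements of `N`. -/
def realizedBy {n : ℕ} (N : Submodule (expansionRing n) (SeriesFamily n)) :
    Submodule ℂ (FormalLogSeries n) where
  carrier := {φ | ∃ F ∈ N, Realizes F φ}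
  zero_mem' := ⟨0, N.zero_mem, Realizes.zero⟩
  add_mem' := by
    rintro φ ψ ⟨F, hF, hφ⟩ ⟨G, hG, hψ⟩
    exact ⟨F + G, N.add_mem hF hG, hφ.add hψ⟩
  smul_mem' := by
    rintro r φ ⟨F, hF, hφ⟩
    refine ⟨r • F, ?_, hφ.smul r⟩
    exact N.smul_of_tower_mem r hF

section realizedBy

variable {n : ℕ} {N : Submodule (expansionRing n) (SeriesFamily n)} {φ : FormalLogSeries n}

theorem laurentMul_mem_realizedBy (h : expansionRing n) (hφ : φ ∈ realizedBy N) :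
    FormalLogSeries.laurentMul h.1.laurentCoeff φ ∈ realizedBy N := by
  obtain ⟨F, hF, hφ⟩ := hφ
  exact ⟨h • F, N.smul_mem h hF, hφ.laurentMul h.1⟩

theorem monomial_single_mem_expansionRing (i : Fin n) (m : ℤ) :
    TailSeries.monomial (Pi.single i m) 1 ∈ expansionRing n := by
  have hpow : ∀ (q : Fin n → ℤ) (k : ℕ),
      TailSeries.monomial q 1 ^ k = TailSeries.monomial (k • q) 1 := by
    intro q k
    simp only [TailSeries.monomial, HahnSeries.single_pow, one_pow, map_nsmul]
  obtain ⟨k, rfl | rfl⟩ := m.eq_nat_or_neg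
  · have h1 : (Pi.single i (k : ℤ) : Fin n → ℤ) = k • Pi.single i 1 := by
      rw [← Pi.single_smul]
      simp
    rw [h1, ← hpow]
    exact (expansionRing n).pow_mem (Algebra.subset_adjoin (Or.inl (Or.inl ⟨i, rfl⟩))) k
  · have h1 : (Pi.single i (-(k : ℤ)) : Fin n → ℤ) = k • -Pi.single i 1 := by
      rw [← Pi.single_neg, ← Pi.single_smul]
      simp
    rw [h1, ← hpow]
    exact (expansionRing n).pow_mem (Algebra.subset_adjoin (Or.inl (Or.inr ⟨i, rfl⟩))) k

/-- Multiplication by `z_i^m`. -/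
theorem shift_mem_realizedBy (i : Fin n) (m : ℤ) (hφ : φ ∈ realizedBy N) :
    (fun p k => φ (p - Pi.single i (m : ℂ)) k) ∈ realizedBy N := by
  convert laurentMul_mem_realizedBy ⟨_, monomial_single_mem_expansionRing i m⟩ hφ using 1
  funext p k
  rw [FormalLogSeries.laurentMul, finsum_eq_single _ (Pi.single i m)]
  · rw [TailSeries.laurentCoeff_monomial, if_pos rfl, one_mul]
    congr 1
    funext j
    rw [Pi.sub_apply, Pi.single_apply, Pi.single_apply]
    split_ifs <;> simp
  · intro q hq
    rw [TailSeries.laurentCoeff_monomial, if_neg hq, zero_mul]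

/-- Multiplication by the expansion of `(z_i - z_j)^(-t-1)`. -/
theorem invDiff_mem_realizedBy {i j : Fin n} (hij : i < j) (t : ℕ) (hφ : φ ∈ realizedBy N) :
    (fun p k => ∑ᶠ s : ℕ, ((t + s).choose t : ℂ) *
      φ (p - Pi.single j (s : ℂ) + Pi.single i ((s : ℂ) + t + 1)) k) ∈ realizedBy N := by
  have hmem : TailSeries.invDiff hij ∈ expansionRing n :=
    Algebra.subset_adjoin (Or.inr ⟨⟨(i, j), hij⟩, rfl⟩)
  convert laurentMul_mem_realizedBy ⟨_, pow_mem hmem (t + 1)⟩ hφ using 1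
  funext p k
  rw [FormalLogSeries.laurentMul]
  have hinj := TailSeries.exponent_injective hij t
  have h1 := finsum_mem_range (f := fun q : Fin n → ℤ =>
    (TailSeries.invDiff hij ^ (t + 1)).laurentCoeff q * φ (fun i => p i - (q i : ℂ)) k) hinj
  refine Eq.trans ?_ (h1.symm.trans ?_)
  · refine finsum_congr fun s => ?_
    rw [TailSeries.laurentCoeff_invDiff_pow]
    congr 2
    funext l
    simp only [Pi.add_apply, Pi.sub_apply, Pi.single_apply]
    split_ifs <;> push_cast <;> ring
  · rw [finsum_mem_def]
    refine finsum_congr fun q => Set.indicator_apply_eq_self.mpr fun hq => ?_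
    rw [TailSeries.laurentCoeff_invDiff_pow_of_notMem hij t q fun s hs => hq ⟨s, hs.symm⟩,
      zero_mul]

theorem exists_fg_realizedBy {Gen : Set (FormalLogSeries n)} (hfin : Gen.Finite)
    (hG : ∀ φ ∈ Gen, ∃ F, Realizes F φ) :
    ∃ N : Submodule (expansionRing n) (SeriesFamily n), N.FG ∧ Gen ⊆ realizedBy N := by
  choose! F hF using hG
  refine ⟨Submodule.span _ (F '' Gen), Submodule.fg_span (hfin.image F), fun φ hφ => ?_⟩
  exact ⟨F φ, Submodule.subset_span ⟨φ, hφ, rfl⟩, hF φ hφ⟩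

/-- A sequence in a Noetherian module satisfies linear recurrences of every large length. -/
theorem exists_linear_recurrence {R M : Type*} [CommRing R] [IsNoetherianRing R] [AddCommGroup M]
    [Module R M] {N : Submodule R M} (hN : N.FG) {F : ℕ → M} (hF : ∀ j, F j ∈ N) :
    ∃ m₀, ∀ m ≥ m₀, ∃ c : Fin m → R, ∑ k : Fin m, c k • F (m - (k + 1)) = F m := by
  have : IsNoetherian R N := isNoetherian_of_fg_of_noetherian N hN
  let G : ℕ → N := fun j => ⟨F j, hF j⟩
  let S : ℕ →o Submodule R N :=
    ⟨fun m => Submodule.span R (Set.range fun k : Fin m => G (m - (k + 1))), by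
      intro a b hab
      rw [Submodule.span_le]
      rintro _ ⟨k, rfl⟩
      refine Submodule.subset_span ⟨⟨b - (a - (k + 1)) - 1, by lia⟩, ?_⟩
      dsimp only
      congr 1
      lia⟩
  obtain ⟨m₀, hm₀⟩ := monotone_stabilizes_iff_noetherian.mpr this S
  refine ⟨m₀, fun m hm => ?_⟩
  have h1 : G m ∈ S m := by
    rw [← hm₀ m hm, hm₀ (m + 1) (by lia)]
    exact Submodule.subset_span ⟨0, by simp⟩
  obtain ⟨c, hc⟩ := (Submodule.mem_span_range_iff_exists_fun _).mp h1
  refine ⟨c, ?_⟩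
  have := congrArg N.subtype hc
  rw [map_sum] at this
  exact this

theorem exists_laurentMul_recurrence (hN : N.FG) {ψ : ℕ → FormalLogSeries n}
    (hψ : ∀ j, ψ j ∈ realizedBy N) :
    ∃ m₀, ∀ m ≥ m₀, ∃ h : Fin m → expansionRing n,
      ψ m + ∑ k : Fin m, FormalLogSeries.laurentMul (h k).1.laurentCoeff (ψ (m - (k + 1))) = 0 := by
  choose F hFN hF using hψ
  obtain ⟨m₀, hm₀⟩ := exists_linear_recurrence (R := expansionRing n) (M := SeriesFamily n) hN hFN
  refine ⟨m₀, fun m hm => ?_⟩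
  obtain ⟨c, hc⟩ := hm₀ m hm
  refine ⟨fun k => -c k, ?_⟩
  have h3 : F m + ∑ k : Fin m, (-c k : expansionRing n).1 • F (m - (k + 1)) = 0 := by
    rw [← hc, ← Finset.sum_add_distrib]
    refine Finset.sum_eq_zero fun k _ => ?_
    funext p q
    change (c k).1 * F (m - (k + 1)) p q + -(c k).1 * F (m - (k + 1)) p q = 0
    ring
  have hsum : ∀ s : Finset (Fin m), Realizes
      (∑ k ∈ s, (-c k : expansionRing n).1 • F (m - (k + 1)))
      (∑ k ∈ s, FormalLogSeries.laurentMul (-c k : expansionRing n).1.laurentCoeff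
        (ψ (m - (k + 1)))) := by
    classical
    intro s
    induction s using Finset.induction_on with
    | empty => exact Realizes.zero
    | insert k s hk ih =>
      rw [Finset.sum_insert hk, Finset.sum_insert hk]
      exact ((hF _).laurentMul _).add ih
  have h5 := (hF m).add (hsum Finset.univ)
  rw [h3] at h5
  exact h5.eq_of Realizes.zero

end realizedBy

/-! ### Gradings -/

namespace IsGrading

variable {M ι : Type*} [AddCommGroup M] [Module ℂ M] {f : ι → Submodule ℂ M}

theorem exists_proj (h : IsGrading f) (i : ι) : ∃ π : M →ₗ[ℂ] M,
    (∀ x, π x ∈ f i) ∧ (∀ x ∈ f i, π x = x) ∧ ∀ j ≠ i, ∀ x ∈ f j, π x = 0 := by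
  have hc : IsCompl (f i) (⨆ (j) (_ : j ≠ i), f j) := by
    refine ⟨h.1 i, codisjoint_iff.mpr ?_⟩
    rw [eq_top_iff, ← h.2]
    refine iSup_le fun j => ?_
    by_cases hj : j = i
    · exact hj ▸ le_sup_left
    · exact le_sup_of_le_right (le_iSup₂_of_le j hj le_rfl)
  refine ⟨(f i).projection _ hc, fun x => ?_, fun x hx => ?_, fun j hj x hx => ?_⟩
  · simp
  · exact Submodule.projection_apply_left hc ⟨x, hx⟩
  · have hx' : x ∈ ⨆ (j) (_ : j ≠ i), f j := by
      exact Submodule.mem_iSup_of_mem j (Submodule.mem_iSup_of_mem hj hx)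
    exact (Submodule.projection_apply_eq_zero_iff hc).mpr hx'

/-- A grading that is contained termwise in an independent family is equal to it. -/
theorem eq_of_le (h : ⨆ i, f i = ⊤) {g : ι → Submodule ℂ M} (hg : iSupIndep g)
    (hle : ∀ i, f i ≤ g i) (i : ι) : f i = g i := by
  refine le_antisymm (hle i) fun x hx => ?_
  have hx' : x ∈ f i ⊔ ⨆ (j) (_ : j ≠ i), f j := by
    have : (⊤ : Submodule ℂ M) ≤ f i ⊔ ⨆ (j) (_ : j ≠ i), f j := by
      rw [← h]
      refine iSup_le fun j => ?_
      by_cases hj : j = i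
      · exact hj ▸ le_sup_left
      · exact le_sup_of_le_right (le_iSup₂_of_le j hj le_rfl)
    exact this trivial
  obtain ⟨y, hy, z, hz, rfl⟩ := Submodule.mem_sup.mp hx'
  have hz' : z ∈ ⨆ (j) (_ : j ≠ i), g j :=
    iSup₂_mono (fun j _ => hle j) hz
  have hz'' : z ∈ g i := by simpa using (g i).sub_mem hx (hle i hy)
  rw [Submodule.disjoint_def.mp (hg i) z hz'' hz', add_zero]
  exact hy

end IsGrading

/-! ### Commutators and weights -/

section Jacobi

variable {V W₁ W₂ W₃ ι : Type*} [AddCommGroup V] [Module ℂ V]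
    [AddCommGroup W₁] [Module ℂ W₁] [AddCommGroup W₂] [Module ℂ W₂]
    [AddCommGroup W₃] [Module ℂ W₃] [Ring ι]
    {Y₁ : VertexAction V W₁} {Y₂ : VertexAction V W₂} {Y₃ : VertexAction V W₃}
    {I : W₁ → W₂ → ι → W₃}

/-- The commutator formula. -/
theorem JacobiIdentity.commutator (h : JacobiIdentity Y₁ Y₂ Y₃ I) (v : V) (a : W₁) (b : W₂)
    (m : ℤ) (n : ι) : Y₃.mode v m (I a b n) - I a (Y₂.mode v m b) n =
      ∑ᶠ i : ℕ, (Ring.choose m i : ℤ) • I (Y₁.mode v i a) b ((m : ι) + n - i) := by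
  have := h v a b 0 m n
  rw [finsum_eq_single _ 0, finsum_eq_single _ 0] at this
  · simpa using this
  · intro i hi
    obtain ⟨j, rfl⟩ := Nat.exists_eq_succ_of_ne_zero hi
    simp
  · intro i hi
    obtain ⟨j, rfl⟩ := Nat.exists_eq_succ_of_ne_zero hi
    simp

/-- The formula for `(u_{-1} a)_n` as a normally ordered product. -/
theorem JacobiIdentity.normalOrder (h : JacobiIdentity Y₁ Y₂ Y₃ I) (v : V) (a : W₁) (b : W₂)
    (n : ι) : I (Y₁.mode v (-1) a) b n =
      (∑ᶠ i : ℕ, Y₃.mode v (-1 - i) (I a b (n + i))) +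
        ∑ᶠ i : ℕ, I a (Y₂.mode v i b) (n - 1 - i) := by
  have hc : ∀ i : ℕ, Ring.choose (-1 : ℤ) i = (-1) ^ i := by
    intro i
    rw [Ring.choose_neg]
    simp [Int.negOnePow_def, Ring.choose_natCast, Units.smul_def]
  have hc' : ∀ i : ℕ, (-1 : ℤ) ^ i * (-1) ^ i = 1 := fun i => by
    rw [← mul_pow]
    simp
  have := h v a b (-1) 0 n
  conv_rhs at this => rw [finsum_eq_single _ 0 (by
    intro i hi
    obtain ⟨j, rfl⟩ := Nat.exists_eq_succ_of_ne_zero hi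
    simp)]
  simp only [hc, hc', mul_assoc, Int.negOnePow_neg, Int.negOnePow_one, Units.val_neg,
    Units.val_one, mul_one, neg_smul, one_smul, finsum_neg_distrib, sub_neg_eq_add, Int.cast_neg,
    Int.cast_one, Int.cast_zero, zero_add, Nat.cast_zero, add_zero, sub_zero,
    Ring.choose_zero_right, ← sub_eq_add_neg] at this
  exact this.symm

/-- The commutator with `L(0)`. -/
theorem JacobiIdentity.L_zero (h : JacobiIdentity Y₁ Y₂ Y₃ I) (ω : V) (a : W₁) (b : W₂) (n : ι) :
    Y₃.L ω 0 (I a b n) = I a (Y₂.L ω 0 b) n + I (Y₁.L ω (-1) a) b (n + 1) +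
      I (Y₁.L ω 0 a) b n := by
  have := h.commutator ω a b 1 n
  rw [finsum_eq_sum_of_support_subset (s := {0, 1})] at this
  · rw [sub_eq_iff_eq_add] at this
    simp only [VertexAction.L, zero_add, neg_add_cancel]
    rw [this, Finset.sum_pair zero_ne_one]
    have h0 : ((1 : ℤ) : ι) + n - (0 : ℕ) = n + 1 := by push_cast; abel
    have h1 : ((1 : ℤ) : ι) + n - (1 : ℕ) = n := by push_cast; abel
    rw [h0, h1, Ring.choose_zero_right, Ring.choose_one_right, one_smul, one_smul,
      Nat.cast_zero, Nat.cast_one]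
    abel
  · intro i hi
    by_contra hc
    apply hi
    obtain ⟨j, rfl⟩ : ∃ j, i = j + 2 := ⟨i - 2, by
      simp only [Finset.coe_pair, Set.mem_insert_iff, Set.mem_singleton_iff] at hc
      lia⟩
    have : Ring.choose (1 : ℤ) (j + 2) = 0 := by
      have := Ring.choose_natCast (R := ℤ) 1 (j + 2)
      rw [Nat.choose_eq_zero_of_lt (by lia)] at this
      exact_mod_cast this
    simp only [this, zero_smul]

end Jacobi

namespace GeneralizedModule

variable {V : Type u} [AddCommGroup V] [Module ℂ V] {X : ConformalVertexAlgebra V}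
  {W : Type w} [AddCommGroup W] [Module ℂ W]

/-- The weight spaces are the full generalized eigenspaces of `L(0)`. -/
theorem wt_eq_maxGenEigenspace (S : GeneralizedModule X W) (n : ℂ) :
    S.wt n = (S.Y.L X.ω 0).maxGenEigenspace n := by
  refine IsGrading.eq_of_le S.wt_grading.2 (Module.End.independent_maxGenEigenspace _) ?_ n
  intro μ x hx
  exact (Module.End.mem_maxGenEigenspace _ _ _).mpr (S.L_zero μ x hx)

theorem mem_wt_of_sub_mem (S : GeneralizedModule X W) {n : ℂ} {x : W}
    (h : S.Y.L X.ω 0 x - n • x ∈ S.wt n) : x ∈ S.wt n := by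
  rw [wt_eq_maxGenEigenspace, Module.End.mem_maxGenEigenspace] at h ⊢
  obtain ⟨k, hk⟩ := h
  refine ⟨k + 1, ?_⟩
  rw [pow_succ, Module.End.mul_apply]
  exact hk

/-- The modes of a homogeneous vector are homogeneous operators. The induction is on the nilpotency
order of `L(0) - n`. -/
theorem mode_mem_wt (S : GeneralizedModule X W) {h : ℤ} {v : V} (hv : v ∈ X.wt h) (m : ℤ)
    {n : ℂ} {x : W} (hx : x ∈ S.wt n) : S.Y.mode v m x ∈ S.wt (n + h - m - 1) := by
  have hcomm : ∀ y : W, S.Y.L X.ω 0 (S.Y.mode v m y) - (n + h - m - 1) • S.Y.mode v m y =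
      S.Y.mode v m (S.Y.L X.ω 0 y - n • y) := by
    intro y
    rw [S.jacobi.L_zero X.ω v y m, S.derivative, X.L_zero h v hv]
    simp only [map_sub, map_smul, Pi.smul_apply, LinearMap.smul_apply, add_sub_cancel_right]
    push_cast
    module
  obtain ⟨k, hk⟩ := S.L_zero n x hx
  induction k generalizing x with
  | zero =>
    rw [pow_zero, Module.End.one_apply] at hk
    rw [hk, map_zero]
    exact Submodule.zero_mem _
  | succ k ih =>
    rw [pow_succ, Module.End.mul_apply] at hk
    refine S.mem_wt_of_sub_mem ?_
    rw [hcomm]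
    refine ih ?_ hk
    rw [wt_eq_maxGenEigenspace] at hx ⊢
    refine Submodule.sub_mem _ ?_ (Submodule.smul_mem _ _ hx)
    exact Module.End.mapsTo_maxGenEigenspace_of_comm rfl n hx

end GeneralizedModule

namespace IsLogIntertwining

section weights

variable {V : Type*} [AddCommGroup V] [Module ℂ V] {X : ConformalVertexAlgebra V}
  {W₁ W₂ W₃ : Type*} [AddCommGroup W₁] [Module ℂ W₁] [AddCommGroup W₂] [Module ℂ W₂]
  [AddCommGroup W₃] [Module ℂ W₃] {S₁ : GeneralizedModule X W₁} {S₂ : GeneralizedModule X W₂}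
  {S₃ : GeneralizedModule X W₃} {𝒴 : LogMap W₁ W₂ W₃}

theorem L_zero_sub (h : IsLogIntertwining X.ω S₁.Y S₂.Y S₃.Y 𝒴) (a : W₁) (b : W₂) (n n₁ n₂ : ℂ)
    (k : ℕ) : S₃.Y.L X.ω 0 (𝒴 a b n k) - (n₁ + n₂ - n - 1) • 𝒴 a b n k =
      𝒴 (S₁.Y.L X.ω 0 a - n₁ • a) b n k + 𝒴 a (S₂.Y.L X.ω 0 b - n₂ • b) n k +
        ((k : ℂ) + 1) • 𝒴 a b n (k + 1) := by
  rw [(h.jacobi k).L_zero X.ω a b n, h.derivative]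
  simp only [map_sub, map_smul, LinearMap.sub_apply, LinearMap.smul_apply, Pi.sub_apply,
    Pi.smul_apply, Finsupp.sub_apply, Finsupp.smul_apply, add_sub_cancel_right]
  module

/-- The coefficients of an intertwining operator are homogeneous for the weights. The induction is
on the nilpotency orders of `L(0) - n₁` and `L(0) - n₂`, and downwards on the power of `log x`. -/
theorem mem_wt (h : IsLogIntertwining X.ω S₁.Y S₂.Y S₃.Y 𝒴) {n₁ n₂ : ℂ} {a : W₁} {b : W₂}
    (ha : a ∈ S₁.wt n₁) (hb : b ∈ S₂.wt n₂) (n : ℂ) (k : ℕ) :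
    𝒴 a b n k ∈ S₃.wt (n₁ + n₂ - n - 1) := by
  have key : ∀ s i j : ℕ, i + j ≤ s → ∀ (a : W₁) (b : W₂),
      ((S₁.Y.L X.ω 0 - n₁ • (1 : Module.End ℂ W₁)) ^ i) a = 0 →
      ((S₂.Y.L X.ω 0 - n₂ • (1 : Module.End ℂ W₂)) ^ j) b = 0 →
      ∀ k, 𝒴 a b n k ∈ S₃.wt (n₁ + n₂ - n - 1) := by
    intro s
    induction s with
    | zero =>
      intro i j hij a b ha _ k
      obtain rfl : i = 0 := by lia
      rw [pow_zero, Module.End.one_apply] at ha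
      simp [ha]
    | succ s ih =>
      intro i j hij a b ha hb
      rcases i with _ | i
      · rw [pow_zero, Module.End.one_apply] at ha
        simp [ha]
      rcases j with _ | j
      · rw [pow_zero, Module.End.one_apply] at hb
        simp [hb]
      rw [pow_succ, Module.End.mul_apply] at ha hb
      obtain ⟨K, hK⟩ := (𝒴 a b n).support.bddAbove
      have hdown : ∀ d k : ℕ, K < k + d → 𝒴 a b n k ∈ S₃.wt (n₁ + n₂ - n - 1) := by
        intro d
        induction d with
        | zero =>
          intro k hk
          have : 𝒴 a b n k = 0 := by
            by_contra hc
            have := hK (Finsupp.mem_support_iff.mpr hc)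
            lia
          rw [this]
          exact Submodule.zero_mem _
        | succ d ihd =>
          intro k hk
          refine S₃.mem_wt_of_sub_mem ?_
          rw [h.L_zero_sub a b n n₁ n₂ k]
          refine Submodule.add_mem _ (Submodule.add_mem _ ?_ ?_)
            (Submodule.smul_mem _ _ (ihd (k + 1) (by lia)))
          · exact ih i (j + 1) (by lia) _ b ha (by rwa [pow_succ, Module.End.mul_apply]) k
          · exact ih (i + 1) j (by lia) a _ (by rwa [pow_succ, Module.End.mul_apply]) hb k
      exact fun k => hdown (K + 1) k (by lia)
  obtain ⟨i, hi⟩ := S₁.L_zero n₁ a ha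
  obtain ⟨j, hj⟩ := S₂.L_zero n₂ b hb
  exact key (i + j) i j le_rfl a b hi hj k

end weights

end IsLogIntertwining

/-! ### Restriction to homogeneous subspaces -/

section fusion

variable {Γ : Type v} [AddCommGroup Γ] {A : AddSubgroup Γ} {V : Type u}
    [AddCommGroup V] [Module ℂ V] {X : StronglyGradedVA A V} {M₁ M₂ M₃ : Type w}
    [AddCommGroup M₁] [Module ℂ M₁] [AddCommGroup M₂] [Module ℂ M₂]
    [AddCommGroup M₃] [Module ℂ M₃] {S₁ : StronglyGradedModule X M₁}
    {S₂ : StronglyGradedModule X M₂} {S₃ : StronglyGradedModule X M₃} {𝒴 : LogMap M₁ M₂ M₃}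

/-- The restriction of a grading-compatible operator to homogeneous subspaces. -/
noncomputable def IsGradingCompatible.restrict (h : IsGradingCompatible S₁ S₂ S₃ 𝒴) (b₁ b₂ : Γ) :
    LogMap (S₁.gr b₁) (S₂.gr b₂) (S₃.gr (b₁ + b₂)) :=
  LinearMap.mk₂ ℂ (fun a b n => Finsupp.onFinset (𝒴 a b n).support
      (fun k => ⟨𝒴 a b n k, h b₁ b₂ a a.2 b b.2 n k⟩) fun k hk =>
        Finsupp.mem_support_iff.mpr fun hc => hk (Subtype.ext hc))
    (fun _ _ _ => by ext; simp) (fun _ _ _ => by ext; simp) (fun _ _ _ => by ext; simp)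
    (fun _ _ _ => by ext; simp)

theorem IsGradingCompatible.coe_restrict (h : IsGradingCompatible S₁ S₂ S₃ 𝒴) (b₁ b₂ : Γ)
    (a : S₁.gr b₁) (b : S₂.gr b₂) (n : ℂ) (k : ℕ) :
    (h.restrict b₁ b₂ a b n k : M₃) = 𝒴 a b n k := rfl

theorem IsGradingCompatible.isLogIntertwining_restrict (h : IsGradingCompatible S₁ S₂ S₃ 𝒴)
    (h𝒴 : IsLogIntertwining X.ω S₁.Y S₂.Y S₃.Y 𝒴) (b₁ b₂ : Γ) :
    IsLogIntertwining (⟨X.ω, X.ω_gr⟩ : X.gr 0) (S₁.homogeneousAction b₁)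
      (S₂.homogeneousAction b₂) (S₃.homogeneousAction (b₁ + b₂)) (h.restrict b₁ b₂) where
  truncation a b n := by
    obtain ⟨N, hN⟩ := h𝒴.truncation a b n
    exact ⟨N, fun m hm k => Subtype.ext (hN m hm k)⟩
  jacobi k v a b l m n := by
    have hinj := (S₃.gr (b₁ + b₂)).injective_subtype
    apply hinj
    have hsum : ∀ g : ℕ → S₃.gr (b₁ + b₂), (S₃.gr (b₁ + b₂)).subtype (∑ᶠ i, g i) =
        ∑ᶠ i, (g i : M₃) := fun g =>
      AddMonoidHom.map_finsum_of_injective (S₃.gr (b₁ + b₂)).subtype.toAddMonoidHom hinj g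
    rw [map_sub, hsum, hsum, hsum]
    exact h𝒴.jacobi k v a b l m n
  derivative a b n k := Subtype.ext (h𝒴.derivative a b n k)

/-- A nonzero coefficient on homogeneous vectors makes the corresponding fusion rule nonzero. -/
theorem fusionRule_ne_zero (h : IsGradingCompatible S₁ S₂ S₃ 𝒴)
    (h𝒴 : IsLogIntertwining X.ω S₁.Y S₂.Y S₃.Y 𝒴) {b₁ b₂ : Γ} {a : M₁} {b : M₂}
    (ha : a ∈ S₁.gr b₁) (hb : b ∈ S₂.gr b₂) {n : ℂ} {k : ℕ} (hne : 𝒴 a b n k ≠ 0) :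
    fusionRule S₁ S₂ S₃ b₁ b₂ ≠ 0 := by
  intro h0
  let T := logIntertwiningSpace (⟨X.ω, X.ω_gr⟩ : X.gr 0) (S₁.homogeneousAction b₁)
    (S₂.homogeneousAction b₂) (S₃.homogeneousAction (b₁ + b₂))
  let _ : AddCommGroup T := Module.addCommMonoidToAddCommGroup ℂ
  have : Subsingleton T := (rank_zero_iff (R := ℂ) (M := T)).mp h0
  have h1 : (⟨h.restrict b₁ b₂, h.isLogIntertwining_restrict h𝒴 b₁ b₂⟩ : T) = 0 :=
    Subsingleton.elim _ _
  have h3 : h.restrict b₁ b₂ = 0 := congrArg Subtype.val h1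
  apply hne
  have h2 := h.coe_restrict b₁ b₂ ⟨a, ha⟩ ⟨b, hb⟩ n k
  rw [h3] at h2
  exact h2.symm

end fusion

/-! ### Matrix elements -/

section tail

variable {n : ℕ} {M : Type*} [AddCommGroup M]

/-- `b_i + b_{i+1} + ⋯ + c`, the last index being reserved for `c`. -/
def tailAdd (b : Fin n → M) (c : M) (i : Fin (n + 1)) : M :=
  (∑ j with i ≤ j.castSucc, b j) + c

theorem tailAdd_last (b : Fin n → M) (c : M) : tailAdd b c (Fin.last n) = c := by
  rw [tailAdd, Finset.sum_eq_zero, zero_add]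
  intro j hj
  exact absurd (Finset.mem_filter.mp hj).2 (not_le.mpr (Fin.castSucc_lt_last j))

theorem tailAdd_castSucc (b : Fin n → M) (c : M) (i : Fin n) :
    tailAdd b c i.castSucc = b i + tailAdd b c i.succ := by
  classical
  have : (Finset.univ.filter fun j : Fin n => i.castSucc ≤ j.castSucc) =
      insert i (Finset.univ.filter fun j : Fin n => i.succ ≤ j.castSucc) := by
    ext j
    simp only [Finset.mem_filter, Finset.mem_univ, true_and, Finset.mem_insert, Fin.le_def,
      Fin.ext_iff, Fin.val_castSucc, Fin.val_succ]
    lia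
  rw [tailAdd, this, Finset.sum_insert (by simp [Fin.le_def]), tailAdd, add_assoc]

end tail

section matrixElement

variable {n : ℕ} {W : Fin n → Type w} {U : Fin (n + 1) → Type w}
    [∀ i, AddCommGroup (W i)] [∀ i, Module ℂ (W i)]
    [∀ i, AddCommGroup (U i)] [∀ i, Module ℂ (U i)]
    (𝒴 : ∀ i : Fin n, LogMap (W i) (U i.succ) (U i.castSucc))

/-- The coefficient of `∏_{j ≥ i} z_j^(p_j) (log z_j)^(k_j)` in `𝒴ᵢ(xᵢ, zᵢ) ⋯ 𝒴ₙ(xₙ, zₙ) y`. -/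
noncomputable def suffixVector (x : ∀ i, W i) (y : U (Fin.last n)) (p : Fin n → ℂ) (k : Fin n → ℕ) :
    ∀ i, U i :=
  Fin.reverseInduction (motive := fun i => U i) y (fun i b => 𝒴 i (x i) b (-(p i) - 1) (k i))

/-- The coefficient of `∏_{j < i} z_j^(p_j) (log z_j)^(k_j)` in the functional
`⟨f, 𝒴₁(x₁, z₁) ⋯ 𝒴_{i-1}(x_{i-1}, z_{i-1}) ·⟩`. -/
noncomputable def prefixFunctional (f : Module.Dual ℂ (U 0)) (x : ∀ i, W i) (p : Fin n → ℂ)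
    (k : Fin n → ℕ) :
    ∀ i, Module.Dual ℂ (U i) :=
  Fin.induction (motive := fun i => Module.Dual ℂ (U i)) f (fun i g =>
    g ∘ₗ Finsupp.lapply (k i) ∘ₗ LinearMap.proj (-(p i) - 1) ∘ₗ 𝒴 i (x i))

variable {𝒴} {f : Module.Dual ℂ (U 0)} {x : ∀ i, W i} {y : U (Fin.last n)}

theorem suffixVector_last (p : Fin n → ℂ) (k : Fin n → ℕ) :
    suffixVector 𝒴 x y p k (Fin.last n) = y := Fin.reverseInduction_last

theorem suffixVector_castSucc (p : Fin n → ℂ) (k : Fin n → ℕ) (i : Fin n) :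
    suffixVector 𝒴 x y p k i.castSucc =
      𝒴 i (x i) (suffixVector 𝒴 x y p k i.succ) (-(p i) - 1) (k i) :=
  Fin.reverseInduction_castSucc _

theorem prefixFunctional_zero (p : Fin n → ℂ) (k : Fin n → ℕ) :
    prefixFunctional 𝒴 f x p k 0 = f := rfl

theorem prefixFunctional_succ (p : Fin n → ℂ) (k : Fin n → ℕ) (i : Fin n) (b : U i.succ) :
    prefixFunctional 𝒴 f x p k i.succ b =
      prefixFunctional 𝒴 f x p k i.castSucc (𝒴 i (x i) b (-(p i) - 1) (k i)) := rfl

theorem matrixElement_eq (p : Fin n → ℂ) (k : Fin n → ℕ) (i : Fin (n + 1)) :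
    matrixElement 𝒴 f x y p k =
      prefixFunctional 𝒴 f x p k i (suffixVector 𝒴 x y p k i) := by
  induction i using Fin.induction with
  | zero => rfl
  | succ i ih => rw [ih, prefixFunctional_succ, suffixVector_castSucc]

theorem suffixVector_congr {x x' : ∀ i, W i} {p p' : Fin n → ℂ} {k k' : Fin n → ℕ}
    (i : Fin (n + 1))
    (h : ∀ j : Fin n, i ≤ j.castSucc → x j = x' j ∧ p j = p' j ∧ k j = k' j) :
    suffixVector 𝒴 x y p k i = suffixVector 𝒴 x' y p' k' i := by
  induction i using Fin.reverseInduction with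
  | last => rw [suffixVector_last, suffixVector_last]
  | cast i ih =>
    obtain ⟨h1, h2, h3⟩ := h i le_rfl
    rw [suffixVector_castSucc, suffixVector_castSucc, h1, h2, h3,
      ih fun j hj => h j ((Fin.castSucc_lt_succ (i := i)).le.trans hj)]

theorem prefixFunctional_congr {x x' : ∀ i, W i} {p p' : Fin n → ℂ} {k k' : Fin n → ℕ}
    (i : Fin (n + 1))
    (h : ∀ j : Fin n, j.castSucc < i → x j = x' j ∧ p j = p' j ∧ k j = k' j) :
    prefixFunctional 𝒴 f x p k i = prefixFunctional 𝒴 f x' p' k' i := by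
  induction i using Fin.induction with
  | zero => rfl
  | succ i ih =>
    obtain ⟨h1, h2, h3⟩ := h i Fin.castSucc_lt_succ
    ext b
    rw [prefixFunctional_succ, prefixFunctional_succ, h1, h2, h3,
      ih fun j hj => h j (hj.trans Fin.castSucc_lt_succ)]

/-- The dependence of a matrix element on the `i`-th vector and the `i`-th exponents. -/
theorem matrixElement_update (i : Fin n) (a : W i) (p p' : Fin n → ℂ) (k k' : Fin n → ℕ)
    (hp : ∀ j ≠ i, p' j = p j) (hk : ∀ j ≠ i, k' j = k j) :
    matrixElement 𝒴 f (Function.update x i a) y p' k' =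
      prefixFunctional 𝒴 f x p k i.castSucc
        (𝒴 i a (suffixVector 𝒴 x y p k i.succ) (-(p' i) - 1) (k' i)) := by
  rw [matrixElement_eq p' k' i.castSucc, suffixVector_castSucc, Function.update_self]
  rw [prefixFunctional_congr (x' := x) (p' := p) (k' := k),
    suffixVector_congr (x' := x) (p' := p) (k' := k)]
  · intro j hj
    have hne : j ≠ i := by
      rintro rfl
      exact absurd hj (not_le.mpr Fin.castSucc_lt_succ)
    exact ⟨Function.update_of_ne hne _ _, hp j hne, hk j hne⟩
  · intro j hj
    have hne : j ≠ i := by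
      rintro rfl
      exact absurd hj (lt_irrefl _)
    exact ⟨Function.update_of_ne hne _ _, hp j hne, hk j hne⟩

variable (𝒴 f x y)

/-- Matrix elements as linear functions of the `i`-th vector. -/
noncomputable def slotMap (i : Fin n) : W i →ₗ[ℂ] FormalLogSeries n where
  toFun a := matrixElement 𝒴 f (Function.update x i a) y
  map_add' a b := by
    funext p k
    simp only [Pi.add_apply, matrixElement_update i _ p p k k (fun _ _ => rfl) (fun _ _ => rfl),
      map_add, LinearMap.add_apply, Finsupp.add_apply]
  map_smul' r a := by
    funext p k
    simp only [Pi.smul_apply, matrixElement_update i _ p p k k (fun _ _ => rfl) (fun _ _ => rfl),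
      map_smul, LinearMap.smul_apply, Finsupp.smul_apply, RingHom.id_apply]

/-- Matrix elements as linear functions of the last vector. -/
noncomputable def lastMap : U (Fin.last n) →ₗ[ℂ] FormalLogSeries n where
  toFun y := matrixElement 𝒴 f x y
  map_add' a b := by
    funext p k
    simp only [Pi.add_apply, matrixElement_eq p k (Fin.last n), suffixVector_last, map_add]
  map_smul' r a := by
    funext p k
    simp only [Pi.smul_apply, matrixElement_eq p k (Fin.last n), suffixVector_last, map_smul,
      RingHom.id_apply]

/-- Matrix elements as linear functions of the functional. -/
noncomputable def functionalMap : Module.Dual ℂ (U 0) →ₗ[ℂ] FormalLogSeries n where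
  toFun f := matrixElement 𝒴 f x y
  map_add' _ _ := rfl
  map_smul' _ _ := rfl

variable {𝒴 f x y}

/-- Membership of matrix elements in a subspace extends to linear spans in every slot. -/
theorem matrixElement_mem_of_span {T : Submodule ℂ (FormalLogSeries n)} {s : ∀ i, Set (W i)}
    (h : ∀ x, (∀ i, x i ∈ s i) → matrixElement 𝒴 f x y ∈ T) (x : ∀ i, W i)
    (hx : ∀ i, x i ∈ Submodule.span ℂ (s i)) : matrixElement 𝒴 f x y ∈ T := by
  classical
  have key : ∀ S : Finset (Fin n), ∀ x : ∀ i, W i, (∀ i ∈ S, x i ∈ Submodule.span ℂ (s i)) →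
      (∀ i ∉ S, x i ∈ s i) → matrixElement 𝒴 f x y ∈ T := by
    intro S
    induction S using Finset.induction_on with
    | empty => exact fun x _ hx => h x fun i => hx i (Finset.notMem_empty i)
    | insert l S hl ih =>
      intro x hx hx'
      have hle : Submodule.span ℂ (s l) ≤ T.comap (slotMap 𝒴 f x y l) := by
        rw [Submodule.span_le]
        intro a ha
        refine ih _ (fun i hi => ?_) fun i hi => ?_
        · have hne : i ≠ l := by
            rintro rfl
            exact hl hi
          rw [Function.update_of_ne hne]
          exact hx i (Finset.mem_insert_of_mem hi)
        · by_cases hne : i = l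
          · subst hne
            rwa [Function.update_self]
          · rw [Function.update_of_ne hne]
            exact hx' i (by simp [hne, hi])
      have := hle (hx l (Finset.mem_insert_self _ _))
      rw [Submodule.mem_comap] at this
      change matrixElement 𝒴 f (Function.update x l (x l)) y ∈ T at this
      rwa [Function.update_eq_self] at this
  exact key Finset.univ x (fun i _ => hx i) fun i hi => absurd (Finset.mem_univ i) hi

end matrixElement

/-! ### Matrix elements of vertex operators -/

section insertion

variable {V : Type u} [AddCommGroup V] [Module ℂ V]
    {n : ℕ} {W : Fin n → Type w} {U : Fin (n + 1) → Type w}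
    [∀ i, AddCommGroup (W i)] [∀ i, Module ℂ (W i)]
    [∀ i, AddCommGroup (U i)] [∀ i, Module ℂ (U i)]
    (YW : ∀ i, VertexAction V (W i)) (YU : ∀ i, VertexAction V (U i))
    (𝒴 : ∀ i : Fin n, LogMap (W i) (U i.succ) (U i.castSucc))
    (f : Module.Dual ℂ (U 0)) (x : ∀ i, W i) (y : U (Fin.last n))

/-- The matrix element with `v_m` inserted to the left of `𝒴ᵢ(xᵢ, zᵢ)`. -/
noncomputable def insertion (v : V) (m : ℤ) (i : Fin (n + 1)) : FormalLogSeries n := fun p k =>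
  prefixFunctional 𝒴 f x p k i ((YU i).mode v m (suffixVector 𝒴 x y p k i))

/-- The series that moving `v_m` past `𝒴ᵢ(xᵢ, zᵢ)` adds to a matrix element. -/
noncomputable def commutatorTerm (v : V) (m : ℤ) (i : Fin n) : FormalLogSeries n := fun p k =>
  ∑ᶠ t : ℕ, (Ring.choose m t : ℤ) •
    matrixElement 𝒴 f (Function.update x i ((YW i).mode v t (x i))) y
      (p - Pi.single i ((m : ℂ) - t)) k

variable {YW YU 𝒴 f x y}

theorem insertion_zero (v : V) (m : ℤ) : insertion YU 𝒴 f x y v m 0 =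
    matrixElement 𝒴 (f ∘ₗ (YU 0).mode v m) x y := rfl

theorem insertion_last (v : V) (m : ℤ) : insertion YU 𝒴 f x y v m (Fin.last n) =
    matrixElement 𝒴 f x ((YU (Fin.last n)).mode v m y) := by
  funext p k
  rw [insertion, suffixVector_last, matrixElement_eq p k (Fin.last n), suffixVector_last]

theorem VertexAction.finite_support_mode {W' M : Type*} [AddCommGroup W'] [Module ℂ W']
    [AddCommGroup M] [Module ℂ M] (Y : VertexAction V W') (v : V) (a : W')
    {g : ℕ → M} (hg : ∀ t : ℕ, Y.mode v t a = 0 → g t = 0) : Function.HasFiniteSupport g := by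
  obtain ⟨N, hN⟩ := Y.truncation v a
  refine (Set.finite_lt_nat N.toNat).subset fun t ht => ?_
  by_contra hc
  exact ht (hg t (hN t (by simp at hc; lia)))

theorem insertion_castSucc {ω : V}
    (h𝒴 : ∀ i, IsLogIntertwining ω (YW i) (YU i.succ) (YU i.castSucc) (𝒴 i))
    (v : V) (m : ℤ) (i : Fin n) :
    insertion YU 𝒴 f x y v m i.castSucc =
      insertion YU 𝒴 f x y v m i.succ + commutatorTerm YW 𝒴 f x y v m i := by
  funext p k
  have h1 := ((h𝒴 i).jacobi (k i)).commutator v (x i) (suffixVector 𝒴 x y p k i.succ) m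
    (-(p i) - 1)
  rw [sub_eq_iff_eq_add'] at h1
  rw [Pi.add_apply, Pi.add_apply, insertion, suffixVector_castSucc, h1, map_add, insertion,
    prefixFunctional_succ, commutatorTerm]
  congr 1
  rw [map_finsum _ ((YW i).finite_support_mode v (x i) fun t ht => by simp [ht])]
  refine finsum_congr fun t => ?_
  have h2 : (m : ℂ) + (-(p i) - 1) - (t : ℂ) =
      -((p - Pi.single i ((m : ℂ) - t) : Fin n → ℂ) i) - 1 := by
    rw [Pi.sub_apply, Pi.single_eq_same]
    ring
  rw [matrixElement_update i _ p _ k k (fun j hj => by simp [hj]) (fun _ _ => rfl), map_zsmul, h2]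

/-- Moving `v_m` from the functional to the left of `𝒴_l`. -/
theorem insertion_zero_eq {ω : V}
    (h𝒴 : ∀ i, IsLogIntertwining ω (YW i) (YU i.succ) (YU i.castSucc) (𝒴 i))
    (v : V) (m : ℤ) (l : Fin (n + 1)) :
    insertion YU 𝒴 f x y v m 0 = insertion YU 𝒴 f x y v m l +
      ∑ j with j.castSucc < l, commutatorTerm YW 𝒴 f x y v m j := by
  classical
  induction l using Fin.induction with
  | zero => simp
  | succ i ih =>
    have : (Finset.univ.filter fun j : Fin n => j.castSucc < i.succ) =
        insert i (Finset.univ.filter fun j : Fin n => j.castSucc < i.castSucc) := by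
      ext j
      simp only [Finset.mem_filter, Finset.mem_univ, true_and, Finset.mem_insert, Fin.lt_def,
        Fin.ext_iff, Fin.val_castSucc, Fin.val_succ]
      lia
    rw [ih, insertion_castSucc h𝒴, this, Finset.sum_insert (by simp), add_assoc]

/-- Moving `v_m` from the left of `𝒴_l` to the last vector. -/
theorem insertion_eq_last {ω : V}
    (h𝒴 : ∀ i, IsLogIntertwining ω (YW i) (YU i.succ) (YU i.castSucc) (𝒴 i))
    (v : V) (m : ℤ) (l : Fin (n + 1)) :
    insertion YU 𝒴 f x y v m l = insertion YU 𝒴 f x y v m (Fin.last n) +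
      ∑ j with l ≤ j.castSucc, commutatorTerm YW 𝒴 f x y v m j := by
  have h1 := insertion_zero_eq (f := f) (x := x) (y := y) h𝒴 v m l
  have h2 := insertion_zero_eq (f := f) (x := x) (y := y) h𝒴 v m (Fin.last n)
  have h3 := Finset.sum_filter_add_sum_filter_not Finset.univ (fun j : Fin n => j.castSucc < l)
    (commutatorTerm YW 𝒴 f x y v m)
  simp only [Fin.castSucc_lt_last, Finset.filter_true, not_lt] at h2 h3
  rw [h1, ← h3, add_left_comm, add_comm] at h2
  exact add_left_cancel h2

/-- A matrix element with `l`-th vector `v_{-1} x_l`, written through the normally ordered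
product. -/
theorem matrixElement_update_mode {ω : V}
    (h𝒴 : ∀ i, IsLogIntertwining ω (YW i) (YU i.succ) (YU i.castSucc) (𝒴 i))
    (v : V) (l : Fin n) (p : Fin n → ℂ) (k : Fin n → ℕ) :
    matrixElement 𝒴 f (Function.update x l ((YW l).mode v (-1) (x l))) y p k =
      (∑ᶠ s : ℕ, insertion YU 𝒴 f x y v (-1 - s) l.castSucc (p - Pi.single l (s : ℂ)) k) +
        ∑ᶠ s : ℕ, insertion YU 𝒴 f x y v s l.succ (p + Pi.single l ((s : ℂ) + 1)) k := by
  have hpre : ∀ q : ℂ, prefixFunctional 𝒴 f x (p + Pi.single l q) k l.castSucc =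
      prefixFunctional 𝒴 f x p k l.castSucc := fun q =>
    prefixFunctional_congr _ fun j hj => ⟨rfl, by
      rw [Pi.add_apply, Pi.single_eq_of_ne (by rintro rfl; exact lt_irrefl _ hj), add_zero], rfl⟩
  have hsuf : ∀ q : ℂ, suffixVector 𝒴 x y (p + Pi.single l q) k l.succ =
      suffixVector 𝒴 x y p k l.succ := fun q =>
    suffixVector_congr _ fun j hj => ⟨rfl, by
      rw [Pi.add_apply, Pi.single_eq_of_ne (by
        rintro rfl; exact absurd hj (not_le.mpr Fin.castSucc_lt_succ)), add_zero], rfl⟩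
  rw [matrixElement_update l _ p p k k (fun _ _ => rfl) (fun _ _ => rfl),
    ((h𝒴 l).jacobi (k l)).normalOrder, map_add, map_finsum, map_finsum]
  · congr 1
    · refine finsum_congr fun s => ?_
      have h1 : -(p l) - 1 + (s : ℂ) = -((p + Pi.single l (-(s : ℂ)) : Fin n → ℂ) l) - 1 := by
        rw [Pi.add_apply, Pi.single_eq_same]
        ring
      rw [insertion, sub_eq_add_neg p, ← Pi.single_neg, hpre, suffixVector_castSucc, hsuf, h1]
    · refine finsum_congr fun s => ?_
      have h1 : -(p l) - 1 - 1 - (s : ℂ) =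
          -((p + Pi.single l ((s : ℂ) + 1) : Fin n → ℂ) l) - 1 := by
        rw [Pi.add_apply, Pi.single_eq_same]
        ring
      rw [insertion, prefixFunctional_succ, hpre, hsuf, h1]
  · refine (YU l.succ).finite_support_mode v (suffixVector 𝒴 x y p k l.succ) fun t ht => ?_
    simp [ht]
  · obtain ⟨N, hN⟩ := (h𝒴 l).truncation (x l) (suffixVector 𝒴 x y p k l.succ) (-(p l) - 1)
    refine (Set.finite_lt_nat N).subset fun t ht => ?_
    by_contra hc
    exact ht (by simp only [hN t (not_lt.mp hc), map_zero])

/-- The derivative of a matrix element. -/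
theorem partialDeriv_matrixElement {ω : V}
    (h𝒴 : ∀ i, IsLogIntertwining ω (YW i) (YU i.succ) (YU i.castSucc) (𝒴 i)) (l : Fin n) :
    FormalLogSeries.partialDeriv l (matrixElement 𝒴 f x y) =
      matrixElement 𝒴 f (Function.update x l ((YW l).L ω (-1) (x l))) y := by
  funext p k
  have h1 : ∀ k', (∀ j ≠ l, k' j = k j) → matrixElement 𝒴 f x y (p + Pi.single l 1) k' =
      prefixFunctional 𝒴 f x p k l.castSucc
        (𝒴 l (x l) (suffixVector 𝒴 x y p k l.succ) (-(p l) - 1 - 1) (k' l)) := by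
    intro k' hk'
    have := matrixElement_update (𝒴 := 𝒴) (f := f) (x := x) (y := y) l (x l) p
      (p + Pi.single l 1) k k' (fun j hj => by simp [hj]) hk'
    rw [Function.update_eq_self] at this
    have h1 : -(p l) - 1 - 1 = -((p + Pi.single l 1 : Fin n → ℂ) l) - 1 := by
      rw [Pi.add_apply, Pi.single_eq_same]
      ring
    rw [this, h1]
  rw [matrixElement_update l _ p p k k (fun _ _ => rfl) (fun _ _ => rfl), (h𝒴 l).derivative,
    FormalLogSeries.partialDeriv, h1 k fun _ _ => rfl,
    h1 (k + Pi.single l 1) fun j hj => by simp [hj]]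
  simp only [map_add, map_smul, smul_eq_mul, Pi.add_apply, Pi.single_eq_same]
  ring

end insertion

/-! ### Reduction of the elements `u_{-1} w` -/

/-- The tail sums of the real parts of the exponents of `φ` are bounded below. -/
def IsTailBounded {n : ℕ} (φ : FormalLogSeries n) : Prop :=
  ∃ C : ℝ, ∀ p k, φ p k ≠ 0 → ∀ i, C ≤ ∑ j ∈ Finset.Ici i, (p j).re

theorem IsTailBounded.hasFiniteSupport {n : ℕ} {φ : FormalLogSeries n} (h : IsTailBounded φ)
    {i j : Fin n} (hij : i < j) (p : Fin n → ℂ) (k : Fin n → ℕ) (c d : ℕ → ℂ) :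
    Function.HasFiniteSupport fun s : ℕ =>
      c s * φ (p - Pi.single j (s : ℂ) + Pi.single i (d s)) k := by
  obtain ⟨C, hC⟩ := h
  refine (Set.finite_le_nat ⌊(∑ l ∈ Finset.Ici j, (p l).re) - C⌋₊).subset fun s hs => ?_
  have h1 := hC _ _ (right_ne_zero_of_mul hs) j
  have h2 : ∀ l ∈ Finset.Ici j, ((p - Pi.single j (s : ℂ) + Pi.single i (d s) : Fin n → ℂ) l).re =
      (p l).re - if j = l then (s : ℝ) else 0 := by
    intro l hl
    have hl' : l ≠ i := by
      rintro rfl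
      exact absurd (Finset.mem_Ici.mp hl) (not_le.mpr hij)
    rw [Pi.add_apply, Pi.sub_apply, Pi.single_eq_of_ne hl', add_zero, Complex.sub_re,
      Pi.single_apply]
    simp only [eq_comm (a := l)]
    split_ifs <;> simp
  rw [Finset.sum_congr rfl h2, Finset.sum_sub_distrib, Finset.sum_ite_eq,
    if_pos (Finset.mem_Ici.mpr le_rfl)] at h1
  exact Nat.le_floor (by linarith)

theorem finsum_eq_finsum_comp {α β M : Type*} [AddCommMonoid M] {e : β → α}
    (he : Function.Injective e) {g : α → M} (hg : ∀ s, s ∉ Set.range e → g s = 0) :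
    ∑ᶠ s, g s = ∑ᶠ s, g (e s) := by
  rw [← finsum_mem_range he, finsum_mem_def]
  exact finsum_congr fun s => (Set.indicator_apply_eq_self.mpr (hg s)).symm

theorem Ring.choose_neg_one_sub (s t : ℕ) :
    Ring.choose (-1 - s : ℤ) t = (-1) ^ t * ((t + s).choose t : ℤ) := by
  have h1 : (-1 - s : ℤ) = -((s : ℤ) + 1) := by ring
  have h2 : (s : ℤ) + 1 + t - 1 = ((t + s : ℕ) : ℤ) := by push_cast; ring
  rw [h1, Ring.choose_neg, h2, Ring.choose_natCast]
  simp [Int.negOnePow_def, Units.smul_def]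

theorem finsum_add_sum_sum {ι : Type*} {Φ : ℕ → ℂ} (hΦ : Function.HasFiniteSupport Φ)
    (L : Finset ι) (T : Finset ℕ) (c : ℕ → ℂ) (g : ι → ℕ → ℕ → ℂ)
    (hg : ∀ j ∈ L, ∀ t, Function.HasFiniteSupport (g j t)) :
    ∑ᶠ s, (Φ s + ∑ j ∈ L, ∑ t ∈ T, c t * g j t s) =
      (∑ᶠ s, Φ s) + ∑ j ∈ L, ∑ t ∈ T, c t * ∑ᶠ s, g j t s := by
  have h1 : ∀ j ∈ L, ∀ t ∈ T, Function.HasFiniteSupport fun s => c t * g j t s :=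
    fun j hj t _ => Set.Finite.subset (hg j hj t) fun s hs => right_ne_zero_of_mul hs
  have h2 : ∀ j ∈ L, Function.HasFiniteSupport fun s => ∑ t ∈ T, c t * g j t s :=
    fun j hj => (T.finite_toSet.biUnion fun t ht => h1 j hj t ht).subset (Finset.support_sum T _)
  rw [finsum_add_distrib hΦ
    ((L.finite_toSet.biUnion fun j hj => h2 j hj).subset (Finset.support_sum L _)),
    finsum_sum_comm _ _ h2]
  congr 1
  refine Finset.sum_congr rfl fun j hj => ?_
  rw [finsum_sum_comm _ _ (h1 j hj)]
  exact Finset.sum_congr rfl fun t _ => (mul_finsum _ _).symm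

section reduction

variable {V : Type u} [AddCommGroup V] [Module ℂ V]
    {n : ℕ} {W : Fin n → Type w} {U : Fin (n + 1) → Type w}
    [∀ i, AddCommGroup (W i)] [∀ i, Module ℂ (W i)]
    [∀ i, AddCommGroup (U i)] [∀ i, Module ℂ (U i)]
    {YW : ∀ i, VertexAction V (W i)} {YU : ∀ i, VertexAction V (U i)}
    {𝒴 : ∀ i : Fin n, LogMap (W i) (U i.succ) (U i.castSucc)}
    {f : Module.Dual ℂ (U 0)} {x : ∀ i, W i} {y : U (Fin.last n)}

theorem commutatorTerm_apply (v : V) (m : ℤ) (j : Fin n) {T : ℕ}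
    (hT : ∀ t : ℕ, T ≤ t → (YW j).mode v t (x j) = 0) (p : Fin n → ℂ) (k : Fin n → ℕ) :
    commutatorTerm YW 𝒴 f x y v m j p k = ∑ t ∈ Finset.range T, ((Ring.choose m t : ℤ) : ℂ) *
      matrixElement 𝒴 f (Function.update x j ((YW j).mode v t (x j))) y
        (p - Pi.single j ((m : ℂ) - t)) k := by
  rw [commutatorTerm, finsum_eq_sum_of_support_subset (s := Finset.range T)]
  · simp only [zsmul_eq_mul]
  · intro t ht
    rw [Finset.coe_range, Set.mem_Iio]
    by_contra hc
    apply ht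
    have h0 : matrixElement 𝒴 f (Function.update x j 0) y = 0 := (slotMap 𝒴 f x y j).map_zero
    simp only [hT t (not_lt.mp hc), h0, Pi.zero_apply, smul_zero]

theorem exists_truncation (v : V) : ∃ T : ℕ, ∀ (j : Fin n) (t : ℕ), T ≤ t →
    (YW j).mode v t (x j) = 0 := by
  choose N hN using fun j => (YW j).truncation v (x j)
  obtain ⟨B, hB⟩ := (Set.finite_range N).bddAbove
  exact ⟨B.toNat, fun j t ht => hN j t ((hB ⟨j, rfl⟩).trans (Int.toNat_le.mp ht))⟩

variable {N : Submodule (expansionRing n) (SeriesFamily n)} {ω : V}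

/-- Matrix elements with last vector `v_{-1} y`. -/
theorem matrixElement_last_mode_mem
    (h𝒴 : ∀ i, IsLogIntertwining ω (YW i) (YU i.succ) (YU i.castSucc) (𝒴 i)) (v : V)
    (hx : ∀ j (t : ℕ), matrixElement 𝒴 f (Function.update x j ((YW j).mode v t (x j))) y ∈
      realizedBy N)
    (hf : matrixElement 𝒴 (f ∘ₗ (YU 0).mode v (-1)) x y ∈ realizedBy N) :
    matrixElement 𝒴 f x ((YU (Fin.last n)).mode v (-1) y) ∈ realizedBy N := by
  obtain ⟨T, hT⟩ := exists_truncation (YW := YW) (x := x) v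
  have h1 := insertion_eq_last (f := f) (x := x) (y := y) h𝒴 v (-1) 0
  rw [insertion_zero, insertion_last] at h1
  rw [← sub_eq_iff_eq_add.mpr h1]
  refine Submodule.sub_mem _ hf (Submodule.sum_mem _ fun j _ => ?_)
  have h2 : commutatorTerm YW 𝒴 f x y v (-1) j = ∑ t ∈ Finset.range T,
      ((Ring.choose (-1) t : ℤ) : ℂ) • fun p k =>
        matrixElement 𝒴 f (Function.update x j ((YW j).mode v t (x j))) y
          (p - Pi.single j (((-1 - t : ℤ)) : ℂ)) k := by
    funext p k
    rw [commutatorTerm_apply v (-1) j (hT j)]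
    simp only [Finset.sum_apply, Pi.smul_apply, smul_eq_mul]
    push_cast
    rfl
  rw [h2]
  exact Submodule.sum_mem _ fun t _ => Submodule.smul_mem _ _ (shift_mem_realizedBy j _ (hx j t))

/-- Matrix elements with `l`-th vector `v_{-1} x_l`. The infinite sums over the modes of `v` are
expansions of powers of `(z_i - z_j)⁻¹`. -/
theorem matrixElement_update_mode_mem
    (h𝒴 : ∀ i, IsLogIntertwining ω (YW i) (YU i.succ) (YU i.castSucc) (𝒴 i)) (v : V) (l : Fin n)
    (hx : ∀ j ≠ l, ∀ t : ℕ, matrixElement 𝒴 f (Function.update x j ((YW j).mode v t (x j))) y ∈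
      realizedBy N)
    (hx' : ∀ j ≠ l, ∀ t : ℕ,
      IsTailBounded (matrixElement 𝒴 f (Function.update x j ((YW j).mode v t (x j))) y))
    (hy : ∀ t : ℕ, matrixElement 𝒴 f x ((YU (Fin.last n)).mode v t y) ∈ realizedBy N)
    (hf : ∀ t : ℕ, matrixElement 𝒴 (f ∘ₗ (YU 0).mode v (-1 - t)) x y ∈ realizedBy N)
    {K : ℕ} (hK : ∀ t ≥ K, matrixElement 𝒴 (f ∘ₗ (YU 0).mode v (-1 - t)) x y = 0) :
    matrixElement 𝒴 f (Function.update x l ((YW l).mode v (-1) (x l))) y ∈ realizedBy N := by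
  classical
  obtain ⟨T, hT⟩ := exists_truncation (YW := YW) (x := x) v
  obtain ⟨K', hK'⟩ : ∃ K' : ℕ, ∀ t ≥ K',
      matrixElement 𝒴 f x ((YU (Fin.last n)).mode v t y) = 0 := by
    obtain ⟨B, hB⟩ := (YU (Fin.last n)).truncation v y
    exact ⟨B.toNat, fun t ht => by
      rw [hB t (Int.toNat_le.mp ht)]
      exact (lastMap 𝒴 f x).map_zero⟩
  set ψ : Fin n → ℕ → FormalLogSeries n := fun j t =>
    matrixElement 𝒴 f (Function.update x j ((YW j).mode v t (x j))) y with hψ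
  set L : Finset (Fin n) := Finset.univ.filter fun j => j.castSucc < l.castSucc with hL
  set R : Finset (Fin n) := Finset.univ.filter fun j => l.succ ≤ j.castSucc with hR
  have hLlt : ∀ j ∈ L, j < l := fun j hj => by simpa [hL] using hj
  have hRlt : ∀ j ∈ R, l < j := fun j hj => by
    simpa [hR, Fin.le_def, Nat.succ_le_iff] using hj
  have hleft : ∀ (p : Fin n → ℂ) (k : Fin n → ℕ), ∑ᶠ s : ℕ,
      insertion YU 𝒴 f x y v (-1 - s) l.castSucc (p - Pi.single l (s : ℂ)) k =
      (∑ s ∈ Finset.range K, matrixElement 𝒴 (f ∘ₗ (YU 0).mode v (-1 - s)) x y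
        (p - Pi.single l ((s : ℤ) : ℂ)) k) +
      ∑ j ∈ L, ∑ t ∈ Finset.range T, -(-1) ^ t * ∑ᶠ s : ℕ, ((t + s).choose t : ℂ) *
        ψ j t (p - Pi.single l (s : ℂ) + Pi.single j ((s : ℂ) + t + 1)) k := by
    intro p k
    have hsub : (Function.support fun s : ℕ => matrixElement 𝒴 (f ∘ₗ (YU 0).mode v (-1 - s)) x y
        (p - Pi.single l ((s : ℤ) : ℂ)) k) ⊆ Finset.range K := by
      intro s hs
      rw [Finset.coe_range, Set.mem_Iio]
      by_contra hc
      exact hs (by dsimp only; rw [hK s (not_lt.mp hc)]; rfl)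
    rw [← finsum_eq_sum_of_support_subset _ hsub,
      ← finsum_add_sum_sum ((Finset.finite_toSet _).subset hsub) L (Finset.range T)
        (fun t => -(-1) ^ t) _ fun j hj t =>
          (hx' j (hLlt j hj).ne t).hasFiniteSupport (hLlt j hj) p k _ _]
    refine finsum_congr fun s => ?_
    rw [← sub_eq_iff_eq_add.mpr (insertion_zero_eq h𝒴 v (-1 - s) l.castSucc), insertion_zero,
      Pi.sub_apply, Pi.sub_apply, Finset.sum_apply, Finset.sum_apply, Int.cast_natCast,
      sub_eq_add_neg, ← Finset.sum_neg_distrib]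
    congr 1
    refine Finset.sum_congr rfl fun j _ => ?_
    rw [commutatorTerm_apply v _ j (hT j), ← Finset.sum_neg_distrib]
    refine Finset.sum_congr rfl fun t _ => ?_
    have h2 : p - Pi.single l (s : ℂ) - Pi.single j (((-1 - s : ℤ) : ℂ) - t) =
        p - Pi.single l (s : ℂ) + Pi.single j ((s : ℂ) + t + 1) := by
      rw [sub_eq_add_neg _ (Pi.single j _), ← Pi.single_neg]
      congr 2
      push_cast
      ring
    rw [Ring.choose_neg_one_sub, h2]
    push_cast
    ring
  have hright : ∀ (p : Fin n → ℂ) (k : Fin n → ℕ), ∑ᶠ s : ℕ,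
      insertion YU 𝒴 f x y v s l.succ (p + Pi.single l ((s : ℂ) + 1)) k =
      (∑ s ∈ Finset.range K', matrixElement 𝒴 f x ((YU (Fin.last n)).mode v s y)
        (p - Pi.single l ((-s - 1 : ℤ) : ℂ)) k) +
      ∑ j ∈ R, ∑ t ∈ Finset.range T, 1 * ∑ᶠ s : ℕ, ((t + s).choose t : ℂ) *
        ψ j t (p - Pi.single j (s : ℂ) + Pi.single l ((s : ℂ) + t + 1)) k := by
    intro p k
    have hsub : (Function.support fun s : ℕ =>
        matrixElement 𝒴 f x ((YU (Fin.last n)).mode v s y)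
          (p - Pi.single l ((-s - 1 : ℤ) : ℂ)) k) ⊆ Finset.range K' := by
      intro s hs
      rw [Finset.coe_range, Set.mem_Iio]
      by_contra hc
      exact hs (by dsimp only; rw [hK' s (not_lt.mp hc)]; rfl)
    have hinj : ∀ t : ℕ, Function.Injective fun s : ℕ => t + s := fun t =>
      add_right_injective t
    -- the terms with `s < t` vanish, so that the sums may be reindexed by `s ↦ t + s`
    let g : Fin n → ℕ → ℕ → ℂ := fun j t s => (s.choose t : ℂ) *
      ψ j t (p - Pi.single j ((s : ℂ) - t) + Pi.single l ((s : ℂ) + 1)) k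
    have hg0 : ∀ j t s, s ∉ Set.range (fun s : ℕ => t + s) → g j t s = 0 := by
      intro j t s hs
      have : s < t := by
        by_contra hc
        exact hs ⟨s - t, by dsimp only; lia⟩
      simp only [g, Nat.choose_eq_zero_of_lt this, Nat.cast_zero, zero_mul]
    have hg1 : ∀ j t s, g j t (t + s) = ((t + s).choose t : ℂ) *
        ψ j t (p - Pi.single j (s : ℂ) + Pi.single l ((s : ℂ) + t + 1)) k := by
      intro j t s
      simp only [g]
      push_cast
      rw [add_sub_cancel_left, add_comm (t : ℂ) s]
    have hgfin : ∀ j ∈ R, ∀ t, Function.HasFiniteSupport (g j t) := by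
      intro j hj t
      have h3 := (hx' j (hRlt j hj).ne' t).hasFiniteSupport (hRlt j hj) p k
        (fun s => ((t + s).choose t : ℂ)) (fun s => (s : ℂ) + t + 1)
      refine (Set.Finite.image (fun s : ℕ => t + s) h3).subset fun s hs => ?_
      obtain ⟨r, rfl⟩ : s ∈ Set.range (fun s : ℕ => t + s) := by
        by_contra hc
        exact hs (hg0 j t s hc)
      exact ⟨r, by rw [Function.mem_support, ← hg1]; exact hs, rfl⟩
    have hg2 : ∀ j t, (∑ᶠ s : ℕ, ((t + s).choose t : ℂ) *
        ψ j t (p - Pi.single j (s : ℂ) + Pi.single l ((s : ℂ) + t + 1)) k) = ∑ᶠ s, g j t s :=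
      fun j t => by rw [finsum_eq_finsum_comp (hinj t) (hg0 j t), finsum_congr (hg1 j t)]
    simp only [hg2]
    rw [← finsum_eq_sum_of_support_subset _ hsub,
      ← finsum_add_sum_sum ((Finset.finite_toSet _).subset hsub) R (Finset.range T)
        (fun _ => 1) g hgfin]
    refine finsum_congr fun s => ?_
    have h4 : p + Pi.single l ((s : ℂ) + 1) = p - Pi.single l ((-s - 1 : ℤ) : ℂ) := by
      rw [sub_eq_add_neg, ← Pi.single_neg]
      congr 2
      push_cast
      ring
    rw [insertion_eq_last h𝒴 v s l.succ, insertion_last,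
      Pi.add_apply, Pi.add_apply, Finset.sum_apply, Finset.sum_apply]
    congr 1
    · rw [h4]
    refine Finset.sum_congr rfl fun j _ => ?_
    rw [commutatorTerm_apply v _ j (hT j)]
    refine Finset.sum_congr rfl fun t _ => ?_
    rw [Ring.choose_natCast, one_mul, add_sub_right_comm]
    simp only [Int.cast_natCast, g, hψ]
  have key : matrixElement 𝒴 f (Function.update x l ((YW l).mode v (-1) (x l))) y =
      ((∑ s ∈ Finset.range K, fun p k => matrixElement 𝒴 (f ∘ₗ (YU 0).mode v (-1 - s)) x y
        (p - Pi.single l ((s : ℤ) : ℂ)) k) +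
      ∑ j ∈ L, ∑ t ∈ Finset.range T, (-(-1) ^ t : ℂ) • fun p k =>
        ∑ᶠ s : ℕ, ((t + s).choose t : ℂ) *
        ψ j t (p - Pi.single l (s : ℂ) + Pi.single j ((s : ℂ) + t + 1)) k) +
      ((∑ s ∈ Finset.range K', fun p k => matrixElement 𝒴 f x ((YU (Fin.last n)).mode v s y)
        (p - Pi.single l ((-s - 1 : ℤ) : ℂ)) k) +
      ∑ j ∈ R, ∑ t ∈ Finset.range T, (1 : ℂ) • fun p k =>
        ∑ᶠ s : ℕ, ((t + s).choose t : ℂ) *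
        ψ j t (p - Pi.single j (s : ℂ) + Pi.single l ((s : ℂ) + t + 1)) k) := by
    funext p k
    rw [matrixElement_update_mode h𝒴, hleft, hright]
    simp only [Pi.add_apply, Finset.sum_apply, Pi.smul_apply, smul_eq_mul]
  rw [key]
  refine Submodule.add_mem _ (Submodule.add_mem _ ?_ ?_) (Submodule.add_mem _ ?_ ?_)
  · exact Submodule.sum_mem _ fun s _ => shift_mem_realizedBy l _ (hf s)
  · exact Submodule.sum_mem _ fun j hj => Submodule.sum_mem _ fun t _ => Submodule.smul_mem _ _
      (invDiff_mem_realizedBy (hLlt j hj) t (hx j (hLlt j hj).ne t))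
  · exact Submodule.sum_mem _ fun s _ => shift_mem_realizedBy l _ (hy s)
  · exact Submodule.sum_mem _ fun j hj => Submodule.sum_mem _ fun t _ => Submodule.smul_mem _ _
      (invDiff_mem_realizedBy (hRlt j hj) t (hx j (hRlt j hj).ne' t))

end reduction

/-! ### Homogeneous subspaces of strongly graded modules -/

namespace StronglyGradedModule

variable {Γ : Type v} [AddCommGroup Γ] {A : AddSubgroup Γ} {V : Type u} [AddCommGroup V]
  [Module ℂ V] {X : StronglyGradedVA A V} {W : Type w} [AddCommGroup W] [Module ℂ W]

/-- The doubly homogeneous subspace `W^(β)_[n]`. -/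
def bigr (S : StronglyGradedModule X W) (β : Γ) (n : ℂ) : Submodule ℂ W := S.wt n ⊓ S.gr β

theorem mode_mem_bigr (S : StronglyGradedModule X W) {α : A} {h : ℤ} {v : V} (hv : v ∈ X.wt h)
    (hv' : v ∈ X.gr α) (m : ℤ) {β : Γ} {n : ℂ} {x : W} (hx : x ∈ S.bigr β n) :
    S.Y.mode v m x ∈ S.bigr (β + α) (n + h - m - 1) :=
  ⟨S.mode_mem_wt hv m hx.1, add_comm β (α : Γ) ▸ S.mode_gr α β v hv' m x hx.2⟩

theorem iSup_bigr (S : StronglyGradedModule X W) : ⨆ (β) (n), S.bigr β n = ⊤ := by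
  rw [← S.gr_grading.2]
  refine iSup_congr fun β => ?_
  rw [S.compatible β]
  rfl

theorem exists_proj_bigr (S : StronglyGradedModule X W) (β : Γ) (n : ℂ) : ∃ π : W →ₗ[ℂ] W,
    (∀ x ∈ S.bigr β n, π x = x) ∧
      ∀ β' n', (β', n') ≠ (β, n) → ∀ x ∈ S.bigr β' n', π x = 0 := by
  obtain ⟨π₁, -, h₁, h₁'⟩ := S.gr_grading.exists_proj β
  obtain ⟨π₂, -, h₂, h₂'⟩ := S.wt_grading.exists_proj n
  refine ⟨π₂ ∘ₗ π₁, fun x hx => ?_, fun β' n' hne x hx => ?_⟩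
  · rw [LinearMap.comp_apply, h₁ x hx.2, h₂ x hx.1]
  · rw [LinearMap.comp_apply]
    by_cases hβ : β' = β
    · subst hβ
      rw [h₁ x hx.2, h₂' n' (fun h => hne (by rw [h])) x hx.1]
    · rw [h₁' β' hβ x hx.2, map_zero]

/-- The elements `u_{-1} x` of weight `n` and degree `β`, for homogeneous `u ∈ (V₀)₊` and `x`. -/
def homogeneousGenerators (S : StronglyGradedModule X W) (A₀ : AddSubgroup Γ)
    (V₀ : Submodule ℂ V) (β : Γ) (n : ℂ) : Set W :=
  {w | ∃ (α : A) (h : ℤ) (u : V) (x : W), (α : Γ) ∈ A₀ ∧ 0 < h ∧ u ∈ V₀ ∧ u ∈ X.wt h ∧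
    u ∈ X.gr α ∧ x ∈ S.bigr (β - α) (n - h) ∧ w = S.Y.mode u (-1) x}

theorem homogeneousGenerators_subset (S : StronglyGradedModule X W) (A₀ : AddSubgroup Γ)
    (V₀ : Submodule ℂ V) (β : Γ) (n : ℂ) :
    S.homogeneousGenerators A₀ V₀ β n ⊆ S.bigr β n := by
  rintro _ ⟨α, h, u, x, -, -, -, hu, hu', hx, rfl⟩
  have := S.mode_mem_bigr hu hu' (-1) hx
  rw [sub_add_cancel, sub_add_cancel] at this
  simpa using this

variable {A₀ : AddSubgroup Γ} {V₀ : Submodule ℂ V}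

/-- The weight spaces of `V₀` are sums of doubly homogeneous subspaces. -/
theorem _root_.StronglyGradedVA.IsGradedSubalgebra.inf_wt_le (hV₀ : X.IsGradedSubalgebra A₀ V₀)
    (h : ℤ) : V₀ ⊓ X.wt h ≤ ⨆ (α : A) (_ : (α : Γ) ∈ A₀), V₀ ⊓ X.wt h ⊓ X.gr α := by
  obtain ⟨π, -, h₁, h₂⟩ := X.wt_grading.exists_proj h
  rintro u ⟨hu, hu'⟩
  have hle : V₀ ≤ (⨆ (α : A) (_ : (α : Γ) ∈ A₀), V₀ ⊓ X.wt h ⊓ X.gr α).comap π := by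
    conv_lhs => rw [hV₀.graded]
    refine iSup_le fun α => iSup_le fun hα => iSup_le fun m v hv => ?_
    rw [Submodule.mem_comap]
    by_cases hm : m = h
    · subst hm
      rw [h₁ v hv.1.2]
      exact Submodule.mem_iSup_of_mem α (Submodule.mem_iSup_of_mem hα hv)
    · rw [h₂ m hm v hv.1.2]
      exact Submodule.zero_mem _
  have := hle hu
  rwa [Submodule.mem_comap, h₁ u hu'] at this

/-- The homogeneous components of an element of `C₁(W)` are sums of homogeneous elements
`u_{-1} x`. -/
theorem proj_mem_span_homogeneousGenerators (S : StronglyGradedModule X W)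
    (hV₀ : X.IsGradedSubalgebra A₀ V₀) {β : Γ} {n : ℂ} {π : W →ₗ[ℂ] W}
    (h₁ : ∀ x ∈ S.bigr β n, π x = x)
    (h₂ : ∀ β' n', (β', n') ≠ (β, n) → ∀ x ∈ S.bigr β' n', π x = 0) {w : W} (hw : w ∈ S.C₁ V₀) :
    π w ∈ Submodule.span ℂ (S.homogeneousGenerators A₀ V₀ β n) := by
  set T := Submodule.span ℂ (S.homogeneousGenerators A₀ V₀ β n)
  have hhom : ∀ (h : ℤ), 0 < h → ∀ (α : A), (α : Γ) ∈ A₀ → ∀ u ∈ V₀ ⊓ X.wt h ⊓ X.gr α,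
      ∀ x : W, π (S.Y.mode u (-1) x) ∈ T := by
    intro h hh α hα u hu x
    have hle : (⊤ : Submodule ℂ W) ≤ T.comap (π ∘ₗ S.Y.mode u (-1)) := by
      rw [← S.iSup_bigr]
      refine iSup_le fun β' => iSup_le fun n' x hx => ?_
      rw [Submodule.mem_comap, LinearMap.comp_apply]
      have hmem := S.mode_mem_bigr hu.1.2 hu.2 (-1) hx
      by_cases hne : (β' + (α : Γ), n' + (h : ℂ) - ((-1 : ℤ) : ℂ) - 1) = (β, n)
      · rw [Prod.mk.injEq] at hne
        rw [hne.1, hne.2] at hmem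
        rw [h₁ _ hmem]
        refine Submodule.subset_span ⟨α, h, u, x, hα, hh, hu.1.1, hu.1.2, hu.2, ?_, rfl⟩
        rw [← hne.1, ← hne.2, add_sub_cancel_right]
        push_cast
        rwa [sub_neg_eq_add, add_sub_cancel_right, add_sub_cancel_right]
      · rw [h₂ _ _ hne _ hmem]
        exact T.zero_mem
    exact hle (x := x) trivial
  refine Submodule.span_induction (p := fun w _ => π w ∈ T) ?_ ?_ ?_ ?_ hw
  · rintro _ ⟨u, hu, x, rfl⟩
    let B : V →ₗ[ℂ] W := π ∘ₗ LinearMap.applyₗ x ∘ₗ LinearMap.proj (-1) ∘ₗ S.Y.mode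
    have hle : (⨆ (m : ℤ) (_ : 0 < m), V₀ ⊓ X.wt m) ≤ T.comap B := by
      refine iSup_le fun m => iSup_le fun hm => (hV₀.inf_wt_le m).trans ?_
      exact iSup_le fun α => iSup_le fun hα u hu => hhom m hm α hα u hu x
    exact hle hu
  · rw [map_zero]
    exact T.zero_mem
  · intro a b _ _ ha hb
    rw [map_add]
    exact T.add_mem ha hb
  · intro r a _ ha
    rw [map_smul]
    exact T.smul_mem r ha

/-- Only in finitely many weights does `W^(β)` contain more than sums of elements `u_{-1} x`: vectors
of different weights that are not such sums are linearly independent modulo `C₁(W)`. -/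
theorem finite_not_le_span (S : StronglyGradedModule X W) (hV₀ : X.IsGradedSubalgebra A₀ V₀)
    (hC : S.IsC₁Cofinite V₀) (β : Γ) :
    {n : ℂ | ¬ S.bigr β n ≤ Submodule.span ℂ (S.homogeneousGenerators A₀ V₀ β n)}.Finite := by
  set M := {n : ℂ | ¬ S.bigr β n ≤ Submodule.span ℂ (S.homogeneousGenerators A₀ V₀ β n)} with hM
  have hex : ∀ n : M, ∃ x ∈ S.bigr β n,
      x ∉ Submodule.span ℂ (S.homogeneousGenerators A₀ V₀ β n) := fun n =>
    Set.not_subset.mp n.2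
  choose x hx hx' using hex
  have := hC β
  have hli : LinearIndependent ℂ fun n : M =>
      ((S.C₁ V₀).submoduleOf (S.gr β)).mkQ ⟨x n, (hx n).2⟩ := by
    rw [linearIndependent_iff']
    intro s g hg j hj
    obtain ⟨π, h₁, h₂⟩ := S.exists_proj_bigr β j
    simp only [← map_smul, ← map_sum] at hg
    rw [Submodule.mkQ_apply, Submodule.Quotient.mk_eq_zero, Submodule.submoduleOf,
      Submodule.mem_comap, Submodule.subtype_apply] at hg
    have h3 := S.proj_mem_span_homogeneousGenerators hV₀ h₁ h₂ hg
    rw [AddSubmonoidClass.coe_finsetSum, map_sum, Finset.sum_eq_single j] at h3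
    · by_contra hgj
      apply hx' j
      rw [Submodule.coe_smul, map_smul, h₁ _ (hx j)] at h3
      exact (Submodule.smul_mem_iff _ hgj).mp h3
    · intro i _ hij
      rw [Submodule.coe_smul, map_smul, h₂ β i (fun h => hij (Subtype.ext (Prod.ext_iff.mp h).2))
        _ (hx i), smul_zero]
    · exact fun h => absurd hj h
  have : Finite M := hli.finite
  exact Set.toFinite M

/-- Modulo the elements `u_{-1} x`, each `W^(β)` is spanned by finitely many homogeneous
elements. -/
theorem exists_finite_generators (S : StronglyGradedModule X W)
    (hV₀ : X.IsGradedSubalgebra A₀ V₀) (hC : S.IsC₁Cofinite V₀) (β : Γ) :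
    ∃ B : Set W, B.Finite ∧ (∀ w ∈ B, ∃ n, w ∈ S.bigr β n) ∧ ∀ n, S.bigr β n ≤
      Submodule.span ℂ ((B ∩ S.bigr β n) ∪ S.homogeneousGenerators A₀ V₀ β n) := by
  have hfg : ∀ n, ∃ B : Set W, B.Finite ∧ Submodule.span ℂ B = S.bigr β n := by
    intro n
    have : FiniteDimensional ℂ (S.bigr β n) := S.finite β n
    exact Submodule.fg_def.mp (Submodule.fg_iff_finiteDimensional _ |>.mpr this)
  choose B hB hB' using hfg
  refine ⟨⋃ n ∈ {n : ℂ | ¬ S.bigr β n ≤ Submodule.span ℂ (S.homogeneousGenerators A₀ V₀ β n)},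
    B n, (S.finite_not_le_span hV₀ hC β).biUnion fun n _ => hB n, ?_, fun n => ?_⟩
  · intro w hw
    obtain ⟨n, -, hn⟩ := Set.mem_iUnion₂.mp hw
    exact ⟨n, hB' n ▸ Submodule.subset_span hn⟩
  · by_cases h : S.bigr β n ≤ Submodule.span ℂ (S.homogeneousGenerators A₀ V₀ β n)
    · exact h.trans (Submodule.span_mono Set.subset_union_right)
    · conv_lhs => rw [← hB' n]
      refine Submodule.span_mono fun w hw => Or.inl ⟨Set.mem_biUnion h hw, ?_⟩
      exact hB' n ▸ Submodule.subset_span hw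

/-- The linear functionals that vanish on all generalized weight spaces other than `W_[n]`. -/
def weightDual (S : StronglyGradedModule X W) (n : ℂ) : Submodule ℂ (Module.Dual ℂ W) :=
  ⨅ (m : ℂ) (_ : m ≠ n), (S.wt m).dualAnnihilator

theorem mem_weightDual (S : StronglyGradedModule X W) {n : ℂ} {f : Module.Dual ℂ W} :
    f ∈ S.weightDual n ↔ ∀ m ≠ n, ∀ x ∈ S.wt m, f x = 0 := by
  simp only [weightDual, Submodule.mem_iInf, Submodule.mem_dualAnnihilator]

theorem contragredientGr_le (S : StronglyGradedModule X W) (β : Γ) :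
    S.contragredientGr β ≤ ⨆ n, S.weightDual n := by
  refine iSup_mono fun n f hf => S.mem_weightDual.mpr fun m hm x hx => ?_
  simp only [Submodule.mem_iInf, Submodule.mem_dualAnnihilator] at hf
  obtain ⟨π, -, h₁, h₂⟩ := S.wt_grading.exists_proj m
  have hle : (⊤ : Submodule ℂ W) ≤ LinearMap.ker (f ∘ₗ π) := by
    rw [← S.iSup_bigr]
    refine iSup_le fun γ => iSup_le fun m' z hz => ?_
    rw [LinearMap.mem_ker, LinearMap.comp_apply]
    by_cases hm' : m' = m
    · subst hm'
      rw [h₁ z hz.1, hf γ m' (fun h => hm h.2) z hz]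
    · rw [h₂ m' hm' z hz.1, map_zero]
  have := hle (x := x) trivial
  rwa [LinearMap.mem_ker, LinearMap.comp_apply, h₁ x hx] at this

theorem comp_mode_mem_weightDual (S : StronglyGradedModule X W) {h : ℤ} {v : V}
    (hv : v ∈ X.wt h) (m : ℤ) {n : ℂ} {f : Module.Dual ℂ W} (hf : f ∈ S.weightDual n) :
    f ∘ₗ S.Y.mode v m ∈ S.weightDual (n - h + m + 1) := by
  rw [mem_weightDual] at hf ⊢
  intro r hr x hx
  refine hf _ (fun hc => hr ?_) _ (S.mode_mem_wt hv m hx)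
  rw [← hc]
  ring

/-- On a doubly homogeneous subspace there are only finitely many functionals, up to linear
combinations. -/
theorem exists_finite_functionals (S : StronglyGradedModule X W) (β : Γ) (n : ℂ) :
    ∃ T : Set (Module.Dual ℂ W), T.Finite ∧ T ⊆ S.weightDual n ∧ ∀ f ∈ S.weightDual n,
      ∃ g ∈ Submodule.span ℂ T, ∀ x ∈ S.bigr β n, f x = g x := by
  have : FiniteDimensional ℂ (S.bigr β n) := S.finite β n
  let r : S.weightDual n →ₗ[ℂ] Module.Dual ℂ (S.bigr β n) :=
    (Submodule.dualRestrict _) ∘ₗ (S.weightDual n).subtype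
  obtain ⟨T, hT, hT'⟩ := Submodule.fg_def.mp
    (Submodule.fg_iff_finiteDimensional (LinearMap.range r) |>.mpr inferInstance)
  have hsub : T ⊆ Set.range r := by
    rw [← LinearMap.coe_range, ← hT']
    exact Submodule.subset_span
  obtain ⟨T', hT'', hfin⟩ : ∃ T' : Set (S.weightDual n), r '' T' = T ∧ T'.Finite := by
    choose! e he using hsub
    refine ⟨e '' T, ?_, hT.image e⟩
    rw [Set.image_image]
    exact (Set.image_congr fun t ht => he ht).trans (Set.image_id' T)
  refine ⟨Subtype.val '' T', hfin.image _, ?_, fun f hf => ?_⟩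
  · rintro _ ⟨g, _, rfl⟩
    exact g.2
  · have h1 : r ⟨f, hf⟩ ∈ (Submodule.span ℂ T').map r := by
      rw [Submodule.map_span, hT'', hT']
      exact ⟨_, rfl⟩
    obtain ⟨g, hg, hgf⟩ := h1
    refine ⟨g, ?_, fun x hx => ?_⟩
    · have : (g : Module.Dual ℂ W) ∈ (Submodule.span ℂ T').map (S.weightDual n).subtype :=
        ⟨g, hg, rfl⟩
      rwa [Submodule.map_span] at this
    · exact (LinearMap.congr_fun hgf ⟨x, hx⟩).symm

end StronglyGradedModule

/-! ### Homogeneous matrix elements -/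

section homogeneous

variable {Γ : Type v} [AddCommGroup Γ] {A : AddSubgroup Γ} {V : Type u} [AddCommGroup V]
    [Module ℂ V] {X : StronglyGradedVA A V}
    {n : ℕ} {W : Fin n → Type w} [∀ i, AddCommGroup (W i)] [∀ i, Module ℂ (W i)]
    {U : Fin (n + 1) → Type w} [∀ i, AddCommGroup (U i)] [∀ i, Module ℂ (U i)]
    {SW : ∀ i, StronglyGradedModule X (W i)} {SU : ∀ i, StronglyGradedModule X (U i)}
    {𝒴 : ∀ i : Fin n, LogMap (W i) (U i.succ) (U i.castSucc)}
    {f : Module.Dual ℂ (U 0)} {x : ∀ i, W i} {y : U (Fin.last n)}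

theorem suffixVector_mem_gr
    (h𝒴gr : ∀ i, IsGradingCompatible (SW i) (SU i.succ) (SU i.castSucc) (𝒴 i))
    {b : Fin n → Γ} {c : Γ} (hx : ∀ i, x i ∈ (SW i).gr (b i))
    (hy : y ∈ (SU (Fin.last n)).gr c) (p : Fin n → ℂ) (k : Fin n → ℕ) (i : Fin (n + 1)) :
    suffixVector 𝒴 x y p k i ∈ (SU i).gr (tailAdd b c i) := by
  induction i using Fin.reverseInduction with
  | last => rwa [suffixVector_last, tailAdd_last]
  | cast i ih =>
    rw [suffixVector_castSucc, tailAdd_castSucc]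
    exact h𝒴gr i _ _ _ (hx i) _ ih _ _

theorem suffixVector_mem_wt
    (h𝒴 : ∀ i, IsLogIntertwining X.ω (SW i).Y (SU i.succ).Y (SU i.castSucc).Y (𝒴 i))
    {μ : Fin n → ℂ} {ν : ℂ} (hx : ∀ i, x i ∈ (SW i).wt (μ i))
    (hy : y ∈ (SU (Fin.last n)).wt ν) (p : Fin n → ℂ) (k : Fin n → ℕ) (i : Fin (n + 1)) :
    suffixVector 𝒴 x y p k i ∈ (SU i).wt (tailAdd (μ + p) ν i) := by
  induction i using Fin.reverseInduction with
  | last => rwa [suffixVector_last, tailAdd_last]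
  | cast i ih =>
    rw [suffixVector_castSucc, tailAdd_castSucc]
    have := (h𝒴 i).mem_wt (hx i) ih (-(p i) - 1) (k i)
    have h1 : μ i + tailAdd (μ + p) ν i.succ - (-(p i) - 1) - 1 =
        (μ + p) i + tailAdd (μ + p) ν i.succ := by
      rw [Pi.add_apply]
      ring
    rwa [h1] at this

theorem isTailBounded_matrixElement
    (hlow : ∀ i, (SU i).IsLowerBounded)
    (h𝒴 : ∀ i, IsLogIntertwining X.ω (SW i).Y (SU i.succ).Y (SU i.castSucc).Y (𝒴 i))
    (h𝒴gr : ∀ i, IsGradingCompatible (SW i) (SU i.succ) (SU i.castSucc) (𝒴 i))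
    {b : Fin n → Γ} {c : Γ} {μ : Fin n → ℂ} {ν : ℂ} (hx : ∀ i, x i ∈ (SW i).bigr (b i) (μ i))
    (hy : y ∈ (SU (Fin.last n)).bigr c ν) : IsTailBounded (matrixElement 𝒴 f x y) := by
  choose N hN using fun i => hlow i (tailAdd b c i)
  obtain ⟨C, hC⟩ := (Set.finite_range fun i : Fin n =>
    N i.castSucc - ∑ j ∈ Finset.Ici i, (μ j).re - ν.re).bddBelow
  refine ⟨C, fun p k hne i => (hC ⟨i, rfl⟩).trans ?_⟩
  have h0 : suffixVector 𝒴 x y p k i.castSucc ≠ 0 := by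
    intro h0
    rw [matrixElement_eq p k i.castSucc, h0, map_zero] at hne
    exact hne rfl
  have h1 : suffixVector 𝒴 x y p k i.castSucc ∈
      (SU i.castSucc).bigr (tailAdd b c i.castSucc) (tailAdd (μ + p) ν i.castSucc) :=
    ⟨suffixVector_mem_wt h𝒴 (fun j => (hx j).1) hy.1 p k i.castSucc,
      suffixVector_mem_gr h𝒴gr (fun j => (hx j).2) hy.2 p k i.castSucc⟩
  have h2 : N i.castSucc ≤ (tailAdd (μ + p) ν i.castSucc).re := by
    by_contra hc
    rw [StronglyGradedModule.bigr, hN i.castSucc _ (not_le.mp hc)] at h1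
    exact h0 ((Submodule.mem_bot ℂ).mp h1)
  have h3 : (Finset.univ.filter fun j : Fin n => i.castSucc ≤ j.castSucc) = Finset.Ici i := by
    ext j
    simp
  rw [tailAdd, h3, Complex.add_re, Complex.re_sum] at h2
  simp only [Pi.add_apply, Complex.add_re, Finset.sum_add_distrib] at h2
  dsimp only
  linarith

/-- A matrix element of homogeneous vectors depends on the functional only through its restriction
to one doubly homogeneous subspace. -/
theorem matrixElement_congr_functional
    (h𝒴 : ∀ i, IsLogIntertwining X.ω (SW i).Y (SU i.succ).Y (SU i.castSucc).Y (𝒴 i))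
    (h𝒴gr : ∀ i, IsGradingCompatible (SW i) (SU i.succ) (SU i.castSucc) (𝒴 i))
    {b : Fin n → Γ} {c : Γ} {μ : Fin n → ℂ} {ν : ℂ} (hx : ∀ i, x i ∈ (SW i).bigr (b i) (μ i))
    (hy : y ∈ (SU (Fin.last n)).bigr c ν) {κ : ℂ} {f g : Module.Dual ℂ (U 0)}
    (hf : f ∈ (SU 0).weightDual κ) (hg : g ∈ (SU 0).weightDual κ)
    (hfg : ∀ z ∈ (SU 0).bigr (tailAdd b c 0) κ, f z = g z) :
    matrixElement 𝒴 f x y = matrixElement 𝒴 g x y := by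
  funext p k
  rw [matrixElement_eq p k 0, matrixElement_eq p k 0, prefixFunctional_zero,
    prefixFunctional_zero]
  have h1 := suffixVector_mem_wt h𝒴 (fun j => (hx j).1) hy.1 p k 0
  have h2 := suffixVector_mem_gr h𝒴gr (fun j => (hx j).2) hy.2 p k 0
  by_cases hκ : tailAdd (μ + p) ν 0 = κ
  · rw [hκ] at h1
    exact hfg _ ⟨h1, h2⟩
  · rw [(SU 0).mem_weightDual.mp hf _ hκ _ h1, (SU 0).mem_weightDual.mp hg _ hκ _ h1]

theorem matrixElement_eq_zero
    (h𝒴 : ∀ i, IsLogIntertwining X.ω (SW i).Y (SU i.succ).Y (SU i.castSucc).Y (𝒴 i))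
    (h𝒴gr : ∀ i, IsGradingCompatible (SW i) (SU i.succ) (SU i.castSucc) (𝒴 i))
    {b : Fin n → Γ} {c : Γ} {μ : Fin n → ℂ} {ν : ℂ} (hx : ∀ i, x i ∈ (SW i).bigr (b i) (μ i))
    (hy : y ∈ (SU (Fin.last n)).bigr c ν) {κ : ℂ} (hf : f ∈ (SU 0).weightDual κ)
    (hκ : (SU 0).bigr (tailAdd b c 0) κ = ⊥) : matrixElement 𝒴 f x y = 0 := by
  rw [matrixElement_congr_functional h𝒴 h𝒴gr hx hy hf (Submodule.zero_mem _)]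
  · exact (functionalMap 𝒴 x y).map_zero
  · intro z hz
    rw [hκ, Submodule.mem_bot] at hz
    rw [hz, map_zero, map_zero]

/-- The total weights of the nonzero matrix elements of given degrees are bounded below. -/
theorem exists_le_total_weight (hlowW : ∀ i, (SW i).IsLowerBounded)
    (hlow : ∀ i, (SU i).IsLowerBounded)
    (h𝒴 : ∀ i, IsLogIntertwining X.ω (SW i).Y (SU i.succ).Y (SU i.castSucc).Y (𝒴 i))
    (h𝒴gr : ∀ i, IsGradingCompatible (SW i) (SU i.succ) (SU i.castSucc) (𝒴 i))
    (b : Fin n → Γ) (c : Γ) : ∃ C : ℝ, ∀ (μ : Fin n → ℂ) (ν κ : ℂ) (f : Module.Dual ℂ (U 0))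
      (x : ∀ i, W i) (y : U (Fin.last n)), f ∈ (SU 0).weightDual κ →
      (∀ i, x i ∈ (SW i).bigr (b i) (μ i)) → y ∈ (SU (Fin.last n)).bigr c ν →
      matrixElement 𝒴 f x y ≠ 0 → C ≤ (κ + ∑ i, μ i + ν).re := by
  choose NW hNW using fun i => hlowW i (b i)
  obtain ⟨Ny, hNy⟩ := hlow (Fin.last n) c
  obtain ⟨Nf, hNf⟩ := hlow 0 (tailAdd b c 0)
  refine ⟨Nf + ∑ i, NW i + Ny, fun μ ν κ f x y hf hx hy hne => ?_⟩
  rw [Complex.add_re, Complex.add_re, Complex.re_sum]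
  refine add_le_add (add_le_add ?_ (Finset.sum_le_sum fun i _ => ?_)) ?_
  · by_contra hc
    exact hne (matrixElement_eq_zero h𝒴 h𝒴gr hx hy hf (hNf _ (not_le.mp hc)))
  · by_contra hc
    have h0 := hx i
    rw [StronglyGradedModule.bigr, hNW i _ (not_le.mp hc), Submodule.mem_bot] at h0
    apply hne
    rw [← Function.update_eq_self i x, h0]
    exact (slotMap 𝒴 f x y i).map_zero
  · by_contra hc
    have h0 := hy
    rw [StronglyGradedModule.bigr, hNy _ (not_le.mp hc), Submodule.mem_bot] at h0
    apply hne
    rw [h0]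
    exact (lastMap 𝒴 f x).map_zero

/-- Only finitely many degrees in given cosets of `A₀` admit nonzero matrix elements. -/
theorem finite_degrees {A₀ : AddSubgroup Γ}
    (hfusion : ∀ (i : Fin n) (β₁ β₂ : Γ), {b : Γ × Γ | b.1 - β₁ ∈ A₀ ∧ b.2 - β₂ ∈ A₀ ∧
        fusionRule (SW i) (SU i.succ) (SU i.castSucc) b.1 b.2 ≠ 0}.Finite)
    (h𝒴 : ∀ i, IsLogIntertwining X.ω (SW i).Y (SU i.succ).Y (SU i.castSucc).Y (𝒴 i))
    (h𝒴gr : ∀ i, IsGradingCompatible (SW i) (SU i.succ) (SU i.castSucc) (𝒴 i))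
    (hn : 0 < n) (β : Fin n → Γ) (γ : Γ) :
    {b : (Fin n → Γ) × Γ | (∀ i, b.1 i - β i ∈ A₀) ∧ b.2 - γ ∈ A₀ ∧
      ∃ (f : Module.Dual ℂ (U 0)) (x : ∀ i, W i) (y : U (Fin.last n)),
        (∀ i, x i ∈ (SW i).gr (b.1 i)) ∧ y ∈ (SU (Fin.last n)).gr b.2 ∧
          matrixElement 𝒴 f x y ≠ 0}.Finite := by
  let F : (Fin n → Γ) × Γ → Fin n → Γ × Γ := fun b i => (b.1 i, tailAdd b.1 b.2 i.succ)
  have hF : Function.Injective F := by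
    intro b b' h
    refine Prod.ext (funext fun i => (Prod.ext_iff.mp (congrFun h i)).1) ?_
    have h1 := (Prod.ext_iff.mp (congrFun h ⟨n - 1, by lia⟩)).2
    have h2 : (⟨n - 1, by lia⟩ : Fin n).succ = Fin.last n := by
      ext
      simp
      lia
    simp only [F] at h1
    rwa [h2, tailAdd_last, tailAdd_last] at h1
  refine Set.Finite.of_finite_image (f := F) ?_ hF.injOn
  refine (Set.Finite.pi fun i : Fin n =>
    hfusion i (β i) (tailAdd β γ i.succ)).subset ?_
  rintro _ ⟨b, ⟨hb, hb', f, x, y, hx, hy, hne⟩, rfl⟩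
  refine Set.mem_univ_pi.mpr fun i => ⟨hb i, ?_, ?_⟩
  · simp only [F, tailAdd]
    rw [add_sub_add_comm, ← Finset.sum_sub_distrib]
    exact A₀.add_mem (A₀.sum_mem fun j _ => hb j) hb'
  · obtain ⟨p, k, hpk⟩ : ∃ p k, matrixElement 𝒴 f x y p k ≠ 0 := by
      by_contra! hc
      exact hne (funext fun p => funext fun k => hc p k)
    refine fusionRule_ne_zero (h𝒴gr i) (h𝒴 i) (hx i)
      (suffixVector_mem_gr h𝒴gr hx hy p k i.succ) (n := -(p i) - 1) (k := k i) fun h0 => hpk ?_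
    rw [matrixElement_eq p k i.castSucc, suffixVector_castSucc, h0, map_zero]

end homogeneous

/-! ### Finite generation -/

section finiteGeneration

variable {Γ : Type v} [AddCommGroup Γ] {A : AddSubgroup Γ} {V : Type u} [AddCommGroup V]
    [Module ℂ V] {X : StronglyGradedVA A V}
    {n : ℕ} {W : Fin n → Type w} [∀ i, AddCommGroup (W i)] [∀ i, Module ℂ (W i)]
    {U : Fin (n + 1) → Type w} [∀ i, AddCommGroup (U i)] [∀ i, Module ℂ (U i)]
    {SW : ∀ i, StronglyGradedModule X (W i)} {SU : ∀ i, StronglyGradedModule X (U i)}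
    {𝒴 : ∀ i : Fin n, LogMap (W i) (U i.succ) (U i.castSucc)}
    {A₀ : AddSubgroup Γ} {V₀ : Submodule ℂ V}

variable (SW SU) in
/-- Homogeneous vectors `x₁, …, xₙ, y` and a homogeneous functional `f`, with degrees in the cosets
`βᵢ + A₀` and `γ + A₀` and with the weight of `f` in `S₀ - ℕ`. -/
structure IsHomogeneousData (A₀ : AddSubgroup Γ) (β : Fin n → Γ) (γ : Γ) (S₀ : Set ℂ)
    (b : Fin n → Γ) (c : Γ) (μ : Fin n → ℂ) (ν κ : ℂ) (f : Module.Dual ℂ (U 0)) (x : ∀ i, W i)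
    (y : U (Fin.last n)) : Prop where
  sub_mem : ∀ i, b i - β i ∈ A₀
  sub_mem_last : c - γ ∈ A₀
  weight : ∃ κ₀ ∈ S₀, ∃ j : ℕ, κ = κ₀ - j
  functional : f ∈ (SU 0).weightDual κ
  slot : ∀ i, x i ∈ (SW i).bigr (b i) (μ i)
  last : y ∈ (SU (Fin.last n)).bigr c ν

variable {β : Fin n → Γ} {γ : Γ} {S₀ : Set ℂ} {b : Fin n → Γ} {c : Γ} {μ : Fin n → ℂ} {ν κ : ℂ}
    {f : Module.Dual ℂ (U 0)} {x : ∀ i, W i} {y : U (Fin.last n)}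

namespace IsHomogeneousData

theorem update (h : IsHomogeneousData SW SU A₀ β γ S₀ b c μ ν κ f x y) (l : Fin n) {b' : Γ}
    {μ' : ℂ} {a : W l} (hb' : b' - b l ∈ A₀) (ha : a ∈ (SW l).bigr b' μ') :
    IsHomogeneousData SW SU A₀ β γ S₀ (Function.update b l b') c (Function.update μ l μ') ν κ f
      (Function.update x l a) y where
  sub_mem i := by
    by_cases hi : i = l
    · subst hi
      rw [Function.update_self, ← sub_add_sub_cancel b' (b i) (β i)]
      exact A₀.add_mem hb' (h.sub_mem i)
    · rw [Function.update_of_ne hi]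
      exact h.sub_mem i
  sub_mem_last := h.sub_mem_last
  weight := h.weight
  functional := h.functional
  slot i := by
    by_cases hi : i = l
    · subst hi
      rwa [Function.update_self, Function.update_self, Function.update_self]
    · rw [Function.update_of_ne hi, Function.update_of_ne hi, Function.update_of_ne hi]
      exact h.slot i
  last := h.last

theorem update_last (h : IsHomogeneousData SW SU A₀ β γ S₀ b c μ ν κ f x y) {c' : Γ}
    {ν' : ℂ} {y' : U (Fin.last n)} (hc' : c' - c ∈ A₀) (hy' : y' ∈ (SU (Fin.last n)).bigr c' ν') :
    IsHomogeneousData SW SU A₀ β γ S₀ b c' μ ν' κ f x y' where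
  sub_mem := h.sub_mem
  sub_mem_last := by
    rw [← sub_add_sub_cancel c' c γ]
    exact A₀.add_mem hc' h.sub_mem_last
  weight := h.weight
  functional := h.functional
  slot := h.slot
  last := hy'

theorem comp_mode (h : IsHomogeneousData SW SU A₀ β γ S₀ b c μ ν κ f x y) {r : ℤ} (hr : 0 < r)
    {v : V} (hv : v ∈ X.wt r) (t : ℕ) :
    IsHomogeneousData SW SU A₀ β γ S₀ b c μ ν (κ - r - t) (f ∘ₗ (SU 0).Y.mode v (-1 - t)) x y where
  sub_mem := h.sub_mem
  sub_mem_last := h.sub_mem_last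
  weight := by
    obtain ⟨κ₀, hκ₀, j, rfl⟩ := h.weight
    refine ⟨κ₀, hκ₀, j + r.toNat + t, ?_⟩
    have : ((r.toNat : ℕ) : ℂ) = (r : ℂ) := by
      have := Int.toNat_of_nonneg hr.le
      exact_mod_cast congrArg (Int.cast (R := ℂ)) this
    push_cast
    rw [this]
    ring
  functional := by
    have := (SU 0).comp_mode_mem_weightDual hv (-1 - t) h.functional
    have h1 : κ - r + ((-1 - t : ℤ) : ℂ) + 1 = κ - r - t := by
      push_cast
      ring
    rwa [h1] at this
  slot := h.slot
  last := h.last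

end IsHomogeneousData

theorem sum_update_eq {M : Type*} [AddCommGroup M] (μ : Fin n → M) (l : Fin n) (a : M) :
    ∑ i, Function.update μ l a i = ∑ i, μ i - μ l + a := by
  classical
  rw [Finset.sum_update_of_mem (Finset.mem_univ l), ← Finset.add_sum_erase _ _ (Finset.mem_univ l),
    ← Finset.erase_eq]
  abel

variable (SW SU 𝒴 A₀ β γ S₀) in
/-- The matrix elements of total weight less than `r` belong to `realizedBy N`. -/
def AllMemBelow (N : Submodule (expansionRing n) (SeriesFamily n)) (r : ℝ) : Prop :=
  ∀ ⦃b c μ ν κ f x y⦄, IsHomogeneousData SW SU A₀ β γ S₀ b c μ ν κ f x y →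
    (κ + ∑ i, μ i + ν).re < r → matrixElement 𝒴 f x y ∈ realizedBy N

variable {N : Submodule (expansionRing n) (SeriesFamily n)} {r : ℝ}

/-- A vector `u_{-1} w` in the last slot reduces to lower total weights. -/
theorem AllMemBelow.last_mem (hN : AllMemBelow SW SU 𝒴 A₀ β γ S₀ N r)
    (h𝒴 : ∀ i, IsLogIntertwining X.ω (SW i).Y (SU i.succ).Y (SU i.castSucc).Y (𝒴 i))
    (h : IsHomogeneousData SW SU A₀ β γ S₀ b c μ ν κ f x y)
    (hlt : (κ + ∑ i, μ i + ν).re < r + 1)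
    (hy : y ∈ (SU (Fin.last n)).homogeneousGenerators A₀ V₀ c ν) :
    matrixElement 𝒴 f x y ∈ realizedBy N := by
  obtain ⟨α, s, v, w, hα, hs, -, hv, hv', hw, rfl⟩ := hy
  have hs' : (1 : ℝ) ≤ s := by exact_mod_cast hs
  have h' := h.update_last (c' := c - α) (by simpa using A₀.neg_mem hα) hw
  simp only [Complex.add_re] at hlt
  refine matrixElement_last_mode_mem (YW := fun i => (SW i).Y) (YU := fun i => (SU i).Y) (𝒴 := 𝒴)
    (ω := X.ω) h𝒴 v (fun j t => ?_) ?_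
  · refine hN (h'.update j (b' := b j + α) (by simpa using hα)
      ((SW j).mode_mem_bigr hv hv' t (h.slot j))) ?_
    rw [sum_update_eq]
    simp only [Complex.add_re, Complex.sub_re, Complex.intCast_re, Complex.one_re]
    push_cast
    have : (0 : ℝ) ≤ t := t.cast_nonneg
    linarith
  · have h1 := h'.comp_mode hs hv 0
    simp only [Nat.cast_zero, sub_zero] at h1
    refine hN h1 ?_
    simp only [Complex.add_re, Complex.sub_re, Complex.intCast_re]
    linarith

/-- A vector `u_{-1} w` in the `l`-th slot reduces to lower total weights. -/
theorem AllMemBelow.slot_mem (hN : AllMemBelow SW SU 𝒴 A₀ β γ S₀ N r)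
    (hlow : ∀ i, (SU i).IsLowerBounded)
    (h𝒴 : ∀ i, IsLogIntertwining X.ω (SW i).Y (SU i.succ).Y (SU i.castSucc).Y (𝒴 i))
    (h𝒴gr : ∀ i, IsGradingCompatible (SW i) (SU i.succ) (SU i.castSucc) (𝒴 i))
    (h : IsHomogeneousData SW SU A₀ β γ S₀ b c μ ν κ f x y)
    (hlt : (κ + ∑ i, μ i + ν).re < r + 1) (l : Fin n)
    (hx : x l ∈ (SW l).homogeneousGenerators A₀ V₀ (b l) (μ l)) :
    matrixElement 𝒴 f x y ∈ realizedBy N := by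
  obtain ⟨α, s, v, w, hα, hs, -, hv, hv', hw, hxl⟩ := hx
  have hs' : (1 : ℝ) ≤ s := by exact_mod_cast hs
  have h' := h.update l (b' := b l - α) (by simpa using A₀.neg_mem hα) hw
  have hxx' : Function.update (Function.update x l w) l
      ((SW l).Y.mode v (-1) (Function.update x l w l)) = x := by
    rw [Function.update_self, Function.update_idem, ← hxl, Function.update_eq_self]
  have htot := sum_update_eq μ l (μ l - s)
  rw [← hxx']
  simp only [Complex.add_re] at hlt
  generalize Function.update x l w = x' at h' ⊢
  generalize Function.update b l (b l - α) = b' at h'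
  generalize Function.update μ l (μ l - s) = μ' at h' htot
  have hslot (j : Fin n) (t : ℕ) := h'.update j (b' := b' j + α) (by simpa using hα)
    ((SW j).mode_mem_bigr hv hv' t (h'.slot j))
  obtain ⟨B, hB⟩ := (SU 0).lower (tailAdd b' c 0) (κ - s)
  refine matrixElement_update_mode_mem (YW := fun i => (SW i).Y) (YU := fun i => (SU i).Y)
    (𝒴 := 𝒴) (x := x') (ω := X.ω) h𝒴 v l (fun j _ t => hN (hslot j t) ?_)
    (fun j _ t => isTailBounded_matrixElement hlow h𝒴 h𝒴gr (hslot j t).slot (hslot j t).last)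
    (fun t => ?_) (fun t => ?_) (K := (-B + 1).toNat) fun t ht => ?_
  · rw [sum_update_eq, htot]
    simp only [Complex.add_re, Complex.sub_re, Complex.intCast_re, Complex.one_re]
    push_cast
    have : (0 : ℝ) ≤ t := t.cast_nonneg
    linarith
  · refine hN (h'.update_last (c' := c + α) (by simpa using hα)
      ((SU (Fin.last n)).mode_mem_bigr hv hv' t h.last)) ?_
    rw [htot]
    simp only [Complex.add_re, Complex.sub_re, Complex.intCast_re, Complex.one_re]
    push_cast
    have : (0 : ℝ) ≤ t := t.cast_nonneg
    linarith
  · refine hN (h'.comp_mode hs hv t) ?_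
    rw [htot]
    simp only [Complex.add_re, Complex.sub_re, Complex.intCast_re, Complex.natCast_re]
    have : (0 : ℝ) ≤ t := t.cast_nonneg
    linarith
  · refine matrixElement_eq_zero h𝒴 h𝒴gr h'.slot h'.last (h'.comp_mode hs hv t).functional ?_
    have := hB (-t) (by lia)
    push_cast at this
    rwa [← sub_eq_add_neg] at this

/-- The weights `κ ∈ S₀ - ℕ` that occur in `W^(δ)`. -/
theorem finite_weights {W' : Type w} [AddCommGroup W'] [Module ℂ W']
    (S : StronglyGradedModule X W') (hS₀ : S₀.Finite) (δ : Γ) :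
    {κ : ℂ | (∃ κ₀ ∈ S₀, ∃ j : ℕ, κ = κ₀ - j) ∧ S.bigr δ κ ≠ ⊥}.Finite := by
  choose B hB using fun κ₀ : ℂ => S.lower δ κ₀
  refine (hS₀.biUnion fun κ₀ _ =>
    ((Set.finite_le_nat (-B κ₀).toNat).image fun j : ℕ => κ₀ - (j : ℂ))).subset ?_
  rintro _ ⟨⟨κ₀, hκ₀, j, rfl⟩, hne⟩
  refine Set.mem_biUnion hκ₀ ⟨j, ?_, rfl⟩
  by_contra hc
  rw [Set.mem_ofPred_eq, not_le] at hc
  apply hne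
  have := hB κ₀ (-j) (by lia)
  push_cast at this
  rwa [← sub_eq_add_neg] at this

/-- All matrix elements with degrees in given cosets of `A₀` lie in one finitely generated module
over the ring of expansions. -/
theorem exists_fg_allMemBelow (hV₀ : X.IsGradedSubalgebra A₀ V₀)
    (hcofW : ∀ i, (SW i).IsC₁Cofinite V₀) (hcof : (SU (Fin.last n)).IsC₁Cofinite V₀)
    (hlowW : ∀ i, (SW i).IsLowerBounded) (hlow : ∀ i, (SU i).IsLowerBounded)
    (h𝒴 : ∀ i, IsLogIntertwining X.ω (SW i).Y (SU i.succ).Y (SU i.castSucc).Y (𝒴 i))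
    (h𝒴gr : ∀ i, IsGradingCompatible (SW i) (SU i.succ) (SU i.castSucc) (𝒴 i))
    (hdeg : {b : (Fin n → Γ) × Γ | (∀ i, b.1 i - β i ∈ A₀) ∧ b.2 - γ ∈ A₀ ∧
      ∃ (f : Module.Dual ℂ (U 0)) (x : ∀ i, W i) (y : U (Fin.last n)),
        (∀ i, x i ∈ (SW i).gr (b.1 i)) ∧ y ∈ (SU (Fin.last n)).gr b.2 ∧
          matrixElement 𝒴 f x y ≠ 0}.Finite) (hS₀ : S₀.Finite) :
    ∃ N : Submodule (expansionRing n) (SeriesFamily n), N.FG ∧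
      ∀ r, AllMemBelow SW SU 𝒴 A₀ β γ S₀ N r := by
  set E := {b : (Fin n → Γ) × Γ | (∀ i, b.1 i - β i ∈ A₀) ∧ b.2 - γ ∈ A₀ ∧
      ∃ (f : Module.Dual ℂ (U 0)) (x : ∀ i, W i) (y : U (Fin.last n)),
        (∀ i, x i ∈ (SW i).gr (b.1 i)) ∧ y ∈ (SU (Fin.last n)).gr b.2 ∧
          matrixElement 𝒴 f x y ≠ 0} with hE
  choose BW hBWfin hBWhom hBW using fun i => (SW i).exists_finite_generators hV₀ (hcofW i)
  choose BU hBUfin hBUhom hBU using (SU (Fin.last n)).exists_finite_generators hV₀ hcof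
  choose T hTfin hTsub hT using (SU 0).exists_finite_functionals
  choose C hC using exists_le_total_weight hlowW hlow h𝒴 h𝒴gr
  obtain ⟨C₀, hC₀⟩ := (hdeg.image fun b => C b.1 b.2).bddBelow
  let K : (Fin n → Γ) × Γ → Set ℂ := fun b =>
    {κ : ℂ | (∃ κ₀ ∈ S₀, ∃ j : ℕ, κ = κ₀ - j) ∧ (SU 0).bigr (tailAdd b.1 b.2 0) κ ≠ ⊥}
  let Gen : Set (FormalLogSeries n) := ⋃ b ∈ E, ⋃ κ ∈ K b,
    (fun d : Module.Dual ℂ (U 0) × (∀ i, W i) × U (Fin.last n) =>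
      matrixElement 𝒴 d.1 d.2.1 d.2.2) ''
        (T (tailAdd b.1 b.2 0) κ ×ˢ (Set.univ.pi fun i => BW i (b.1 i)) ×ˢ BU b.2)
  have hGenfin : Gen.Finite := hdeg.biUnion fun b _ =>
    (finite_weights (SU 0) hS₀ _).biUnion fun κ _ => Set.Finite.image _
      ((hTfin _ _).prod ((Set.Finite.pi fun i => hBWfin i _).prod (hBUfin _)))
  obtain ⟨N, hNfg, hN⟩ := exists_fg_realizedBy hGenfin (by
    intro φ hφ
    obtain ⟨b, hb, hφ⟩ := Set.mem_iUnion₂.mp hφ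
    obtain ⟨κ, hκ, ⟨⟨f, x, y⟩, ⟨hf, hx, hy⟩, rfl⟩⟩ := Set.mem_iUnion₂.mp hφ
    choose μ hμ using fun i => hBWhom i _ (x i) (Set.mem_univ_pi.mp hx i)
    obtain ⟨ν, hν⟩ := hBUhom _ y hy
    obtain ⟨C, hC⟩ := isTailBounded_matrixElement (f := f) hlow h𝒴 h𝒴gr hμ hν
    exact Realizes.exists_of_bddBelow C hC)
  refine ⟨N, hNfg, ?_⟩
  -- The matrix elements of the chosen spanning vectors. Functionals may be replaced by
  -- combinations of the chosen ones because they agree on the only subspace that matters.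
  have hbase : ∀ ⦃b c μ ν κ f x y⦄, IsHomogeneousData SW SU A₀ β γ S₀ b c μ ν κ f x y →
      (b, c) ∈ E → (∀ i, x i ∈ BW i (b i)) → y ∈ BU c → matrixElement 𝒴 f x y ∈ realizedBy N := by
    intro b c μ ν κ f x y h hbc hx hy
    by_cases hκ : (SU 0).bigr (tailAdd b c 0) κ = ⊥
    · rw [matrixElement_eq_zero h𝒴 h𝒴gr h.slot h.last h.functional hκ]
      exact Submodule.zero_mem _
    obtain ⟨g, hg, hfg⟩ := hT (tailAdd b c 0) κ f h.functional
    rw [matrixElement_congr_functional h𝒴 h𝒴gr h.slot h.last h.functional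
      (Submodule.span_le.mpr (hTsub _ _) hg) hfg]
    have hle : Submodule.span ℂ (T (tailAdd b c 0) κ) ≤
        (realizedBy N).comap (functionalMap 𝒴 x y) := by
      rw [Submodule.span_le]
      intro g hg
      refine hN (Set.mem_biUnion hbc (Set.mem_biUnion (show κ ∈ K (b, c) from ⟨h.weight, hκ⟩) ?_))
      exact ⟨(g, x, y), ⟨hg, Set.mem_univ_pi.mpr hx, hy⟩, rfl⟩
    exact hle hg
  -- Induction on the total weight, which is at least `C₀` for nonzero matrix elements.
  have hstep : ∀ s : ℕ, AllMemBelow SW SU 𝒴 A₀ β γ S₀ N (C₀ + s) := by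
    intro s
    induction s with
    | zero =>
      intro b c μ ν κ f x y h hlt
      by_cases h0 : matrixElement 𝒴 f x y = 0
      · rw [h0]
        exact Submodule.zero_mem _
      have hbc : (b, c) ∈ E := ⟨h.sub_mem, h.sub_mem_last, f, x, y, fun i => (h.slot i).2,
        h.last.2, h0⟩
      have h1 := hC b c μ ν κ f x y h.functional h.slot h.last h0
      have h2 := hC₀ ⟨(b, c), hbc, rfl⟩
      simp only [Nat.cast_zero, add_zero] at hlt
      dsimp only at h2
      linarith
    | succ s ih =>
      intro b c μ ν κ f x y h hlt
      push_cast at hlt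
      rw [← add_assoc] at hlt
      by_cases h0 : matrixElement 𝒴 f x y = 0
      · rw [h0]
        exact Submodule.zero_mem _
      have hbc : (b, c) ∈ E := ⟨h.sub_mem, h.sub_mem_last, f, x, y, fun i => (h.slot i).2,
        h.last.2, h0⟩
      -- The vectors are reduced to spanning vectors modulo the elements `u_{-1} w`.
      have hlast : (SU (Fin.last n)).bigr c ν ≤ (realizedBy N).comap (lastMap 𝒴 f x) := by
        refine (hBU c ν).trans (Submodule.span_le.mpr ?_)
        rintro y' (⟨hy', hy''⟩ | hy')
        · refine matrixElement_mem_of_span (T := realizedBy N) (s := fun i =>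
            (BW i (b i) ∩ (SW i).bigr (b i) (μ i)) ∪
              (SW i).homogeneousGenerators A₀ V₀ (b i) (μ i)) (fun x' hx' => ?_) x
            fun i => hBW i (b i) (μ i) (h.slot i)
          have h' : IsHomogeneousData SW SU A₀ β γ S₀ b c μ ν κ f x' y' :=
            ⟨h.sub_mem, h.sub_mem_last, h.weight, h.functional, fun i => (hx' i).elim
              (fun hi => hi.2) fun hi => (SW i).homogeneousGenerators_subset A₀ V₀ _ _ hi, hy''⟩
          by_cases hall : ∀ i, x' i ∈ BW i (b i)
          · exact hbase h' hbc hall hy'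
          · obtain ⟨l, hl⟩ := not_forall.mp hall
            exact ih.slot_mem hlow h𝒴 h𝒴gr h' hlt l ((hx' l).resolve_left fun h => hl h.1)
        · exact ih.last_mem h𝒴 (h.update_last (by simp)
            ((SU (Fin.last n)).homogeneousGenerators_subset A₀ V₀ _ _ hy')) hlt hy'
      exact hlast h.last
  intro r b c μ ν κ f x y h _
  obtain ⟨s, hs⟩ := exists_nat_gt ((κ + ∑ i, μ i + ν).re - C₀)
  exact hstep s h (by linarith)

/-- The same for vectors and functionals that are homogeneous only for the second grading. -/
theorem matrixElement_mem_of_gr (hN : ∀ r, AllMemBelow SW SU 𝒴 A₀ β γ S₀ N r)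
    (hf : f ∈ ⨆ κ ∈ S₀, (SU 0).weightDual κ) (hx : ∀ i, x i ∈ (SW i).gr (β i))
    (hy : y ∈ (SU (Fin.last n)).gr γ) : matrixElement 𝒴 f x y ∈ realizedBy N := by
  have hle : (⨆ κ ∈ S₀, (SU 0).weightDual κ) ≤ (realizedBy N).comap (functionalMap 𝒴 x y) := by
    refine iSup₂_le fun κ hκ f hf => ?_
    have hle' : (SU (Fin.last n)).gr γ ≤ (realizedBy N).comap (lastMap 𝒴 f x) := by
      rw [(SU (Fin.last n)).compatible γ]
      refine iSup_le fun ν y hy => ?_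
      refine matrixElement_mem_of_span (T := realizedBy N)
        (s := fun i => ⋃ μ, ((SW i).bigr (β i) μ : Set (W i))) (fun x hx => ?_) x fun i => ?_
      · choose μ hμ using fun i => Set.mem_iUnion.mp (hx i)
        exact hN _ ⟨by simp [A₀.zero_mem], by simp [A₀.zero_mem], ⟨κ, hκ, 0, by simp⟩, hf, hμ, hy⟩
          (lt_add_one _)
      · rw [← Submodule.iSup_eq_span]
        have := hx i
        rw [(SW i).compatible (β i)] at this
        exact this
    exact hle' hy
  exact hle hf

end finiteGeneration

/-! ### The differential equations -/

/-- The modules `W₁, …, Wₙ` are `W 0, …, W (n-1)`, and the modules `W₀, W̃₁, …, W̃_{n-1}, W_{n+1}` are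
`U 0, …, U n`, so that `𝒴 i` is of type `U i` over `W i`, `U (i+1)`. The element of index `k` of
`Fin m` belongs to the derivative of order `m - (k+1)`. -/
theorem theorem5p7 {Γ : Type v} [AddCommGroup Γ] (A A₀ : AddSubgroup Γ)
    {V : Type u} [AddCommGroup V] [Module ℂ V] (X : StronglyGradedVA A V)
    (V₀ : Submodule ℂ V) (hV₀ : X.IsGradedSubalgebra A₀ V₀)
    (hmod : ∀ (M : Type w) [AddCommGroup M] [Module ℂ M] (S : StronglyGradedModule X M),
      S.IsRealGraded ∧ S.IsLowerBounded ∧ S.IsC₁Cofinite V₀)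
    (hfusion : ∀ (M₁ M₂ M₃ : Type w) [AddCommGroup M₁] [Module ℂ M₁] [AddCommGroup M₂]
      [Module ℂ M₂] [AddCommGroup M₃] [Module ℂ M₃] (S₁ : StronglyGradedModule X M₁)
      (S₂ : StronglyGradedModule X M₂) (S₃ : StronglyGradedModule X M₃) (β₁ β₂ : Γ),
      {b : Γ × Γ | b.1 - β₁ ∈ A₀ ∧ b.2 - β₂ ∈ A₀ ∧
        fusionRule S₁ S₂ S₃ b.1 b.2 ≠ 0}.Finite)
    (n : ℕ) (W : Fin n → Type w) [∀ i, AddCommGroup (W i)] [∀ i, Module ℂ (W i)]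
    (U : Fin (n + 1) → Type w) [∀ i, AddCommGroup (U i)] [∀ i, Module ℂ (U i)]
    (SW : ∀ i, StronglyGradedModule X (W i)) (SU : ∀ i, StronglyGradedModule X (U i))
    (𝒴 : ∀ i : Fin n, LogMap (W i) (U i.succ) (U i.castSucc))
    (h𝒴 : ∀ i, IsLogIntertwining X.ω (SW i).Y (SU i.succ).Y (SU i.castSucc).Y (𝒴 i))
    (h𝒴gr : ∀ i, IsGradingCompatible (SW i) (SU i.succ) (SU i.castSucc) (𝒴 i))
    (f : Module.Dual ℂ (U 0)) (hf : ∃ β, f ∈ (SU 0).contragredientGr β)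
    (x : ∀ i, W i) (hx : ∀ i, ∃ β, x i ∈ (SW i).gr β)
    (y : U (Fin.last n)) (hy : ∃ β, y ∈ (SU (Fin.last n)).gr β) :
    ∃ m : ℕ, 0 < m ∧
      ∃ a : Fin m → Fin n → ConfigurationSpace n → ℂ, (∀ k l, a k l ∈ coefficientRing n) ∧
      ∃ c : Fin m → Fin n → (Fin n → ℤ) → ℂ, (∀ k l, IsExpansion (a k l) (c k l)) ∧
      ∀ l : Fin n,
        (FormalLogSeries.partialDeriv l)^[m] (matrixElement 𝒴 f x y) +
          ∑ k : Fin m, FormalLogSeries.laurentMul (c k l)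
            ((FormalLogSeries.partialDeriv l)^[m - (k + 1)] (matrixElement 𝒴 f x y)) = 0 := by
  obtain rfl | hn := n.eq_zero_or_pos
  · exact ⟨1, one_pos, 0, fun _ l => l.elim0, 0, fun _ l => l.elim0, fun l => l.elim0⟩
  obtain ⟨β₀, hf⟩ := hf
  choose β hx using hx
  obtain ⟨γ, hy⟩ := hy
  obtain ⟨S₀, hfS₀⟩ :=
    Submodule.mem_iSup_iff_exists_finset.mp ((SU 0).contragredientGr_le β₀ hf)
  obtain ⟨N, hNfg, hN⟩ := exists_fg_allMemBelow (S₀ := S₀) hV₀ (fun i => (hmod _ (SW i)).2.2)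
    (hmod _ (SU (Fin.last n))).2.2 (fun i => (hmod _ (SW i)).2.1) (fun i => (hmod _ (SU i)).2.1)
    h𝒴 h𝒴gr (finite_degrees (fun i => hfusion _ _ _ (SW i) (SU i.succ) (SU i.castSucc)) h𝒴 h𝒴gr
      hn β γ) S₀.finite_toSet
  have hderiv : ∀ (l : Fin n) (j : ℕ),
      (FormalLogSeries.partialDeriv l)^[j] (matrixElement 𝒴 f x y) ∈ realizedBy N := by
    intro l j
    induction j generalizing x with
    | zero => exact matrixElement_mem_of_gr hN hfS₀ hx hy
    | succ j ih =>
      rw [Function.iterate_succ_apply, partialDeriv_matrixElement (YW := fun i => (SW i).Y)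
        (YU := fun i => (SU i).Y) h𝒴]
      refine ih _ fun i => ?_
      by_cases hi : i = l
      · subst hi
        rw [Function.update_self]
        have := (SW i).mode_gr 0 (β i) X.ω X.ω_gr (-1 + 1) (x i) (hx i)
        rwa [ZeroMemClass.coe_zero, zero_add] at this
      · rw [Function.update_of_ne hi]
        exact hx i
  choose m₀ hm₀ using fun l => exists_laurentMul_recurrence hNfg (hderiv l)
  -- One order `m` serves all variables.
  have hle : ∀ l, m₀ l ≤ ∑ l, m₀ l + 1 := fun l =>
    (Finset.single_le_sum (fun _ _ => Nat.zero_le _) (Finset.mem_univ l)).trans (Nat.le_succ _)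
  choose h hh using fun l => hm₀ l _ (hle l)
  choose a ha hac using fun l k => exists_isExpansion_of_mem (h l k).2
  exact ⟨∑ l, m₀ l + 1, Nat.succ_pos _, fun k l => a l k, fun k l => ha l k,
    fun k l => (h l k).1.laurentCoeff, fun k l => hac l k, hh⟩
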